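/- Let $0<s<1$, let $V\colon\mathbb{R}^2\to\mathbb{R}$ be continuous with $V(x)\ge V_0$ for all $x$, for some constant $V_0>0$, and suppose $1/V\in L^1(\mathbb{R}^2)$. Write $\mathbb{R}^3_+=\{(x,t):x\in\mathbb{R}^2,\ t>0\}$ and let $$H(\mathbb{R}^3_+)=\Big\{u\in L^2(\mathbb{R}^3_+):\ \iint_{\mathbb{R}^3_+}\big[|\nabla u(x,t)|^2+V(x)|u(x,t)|^2\big]\,t^{1-2s}\,dx\,dt<\infty\Big\}$$ be the extension space for $(-\Delta+V)^s$, where $u$ is real-valued, $\nabla u=(\nabla_x u,\partial_t u)$ is the weak gradient (a locally integrable function on $\mathbb{R}^3_+$), and $H(\mathbb{R}^3_+)$ carries the norm $$\|u\|_H=\Big(\iint_{\mathbb{R}^3_+}\big[|\nabla u|^2+V(x)|u|^2\big]\,t^{1-2s}\,dx\,dt\Big)^{1/2}.$$ Then the embedding $H(\mathbb{R}^3_+)\subset L^2(\mathbb{R}^2)$ in the trace sense is well defined and compact: there is a bounded linear operator $T\colon H(\mathbb{R}^3_+)\to L^2(\mathbb{R}^2)$ such that, for every $u\in H(\mathbb{R}^3_+)$,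 $Tu$ is the trace of $u$ at $t=0$, i.e. $\|u(\cdot,t)-Tu\|_{L^2(\mathbb{R}^2)}\to0$ as $t\downarrow0$ (outside a Lebesgue-null set of values of $t$, which depends on the representative of $u$), and $T$ is a compact operator. -/

import Mathlib

open MeasureTheory Filter Topology
open scoped ContDiff

noncomputable section

namespace SchrodingerExtension

/-- The plane `ℝ²` with its Euclidean norm. -/
abbrev Plane : Type := EuclideanSpace ℝ (Fin 2)

/-- The open half-space `ℝ³₊ = {(x, t) : x ∈ ℝ², t > 0}`. -/
def halfSpace : Set (Plane × ℝ) := {p | 0 < p.2}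

/-- Lebesgue measure `dx dt` on `ℝ³₊`. -/
def halfMeasure : Measure (Plane × ℝ) := volume.restrict halfSpace

/-- The measure `t^(1-2s) dx dt` on `ℝ³₊`. -/
def gradMeasure (s : ℝ) : Measure (Plane × ℝ) :=
  halfMeasure.withDensity fun p => ENNReal.ofReal (p.2 ^ (1 - 2 * s))

/-- The measure `V(x) t^(1-2s) dx dt` on `ℝ³₊`. -/
def potMeasure (V : Plane → ℝ) (s : ℝ) : Measure (Plane × ℝ) :=
  halfMeasure.withDensity fun p => ENNReal.ofReal (V p.1 * p.2 ^ (1 - 2 * s))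

/-- Values of the full gradient `∇u = (∇ₓu, ∂ₜu)`, with the Euclidean norm
`|∇u|² = |∇ₓu|² + |∂ₜu|²`. -/
abbrev Grad : Type := WithLp 2 (Plane × ℝ)

/-- `g` is the weak (distributional) gradient of `u` on `ℝ³₊`: both are locally integrable on the
open half-space, and `∫ u ∂ᵥφ = - ∫ ⟨g, v⟩ φ` for all directions `v` and all
`φ ∈ C_c^∞(ℝ³₊)`. -/
structure HasWeakGradient (u : Plane × ℝ → ℝ) (g : Plane × ℝ → Grad) : Prop where
  locInt_fun : LocallyIntegrableOn u halfSpace volume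
  locInt_grad : LocallyIntegrableOn g halfSpace volume
  byParts : ∀ φ : Plane × ℝ → ℝ, ContDiff ℝ ∞ φ → HasCompactSupport φ → tsupport φ ⊆ halfSpace →
    ∀ v : Plane × ℝ,
      ∫ p, u p * fderiv ℝ φ p v ∂halfMeasure
        = - ∫ p, inner ℝ (g p) (WithLp.toLp 2 v) * φ p ∂halfMeasure

lemma measurableSet_halfSpace : MeasurableSet halfSpace :=
  measurableSet_lt measurable_const measurable_snd

lemma integrable_mul {h ψ : Plane × ℝ → ℝ} (hh : LocallyIntegrableOn h halfSpace volume)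
    (hψ : Continuous ψ) (hc : HasCompactSupport ψ) (hs : tsupport ψ ⊆ halfSpace) :
    Integrable (fun p => h p * ψ p) halfMeasure := by
  have h1 : IntegrableOn h (tsupport ψ) volume := hh.integrableOn_compact_subset hs hc
  have h2 : IntegrableOn (fun p => h p * ψ p) (tsupport ψ) volume :=
    h1.mul_continuousOn hψ.continuousOn hc
  have h3 : Integrable (fun p => h p * ψ p) volume := by
    rw [← integrableOn_iff_integrable_of_support_subset (s := tsupport ψ)]
    · exact h2
    · intro p hp
      exact subset_tsupport ψ (right_ne_zero_of_mul hp)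
  exact h3.mono_measure Measure.restrict_le_self

lemma HasWeakGradient.inner_locInt {g : Plane × ℝ → Grad}
    (hg : LocallyIntegrableOn g halfSpace volume) (v : Grad) :
    LocallyIntegrableOn (fun p => inner ℝ (g p) v) halfSpace volume := by
  intro x hx
  obtain ⟨U, hU, hUi⟩ := hg x hx
  exact ⟨U, hU, hUi.inner_const v⟩

lemma HasWeakGradient.integrable_left {u : Plane × ℝ → ℝ} {g : Plane × ℝ → Grad}
    (h : HasWeakGradient u g) {φ : Plane × ℝ → ℝ} (hφ : ContDiff ℝ ∞ φ) (hc : HasCompactSupport φ)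
    (hs : tsupport φ ⊆ halfSpace) (v : Plane × ℝ) :
    Integrable (fun p => u p * fderiv ℝ φ p v) halfMeasure :=
  integrable_mul h.locInt_fun
    ((hφ.continuous_fderiv (by simp)).clm_apply continuous_const)
    (hc.fderiv_apply ℝ v) ((tsupport_fderiv_apply_subset ℝ v).trans hs)

lemma HasWeakGradient.integrable_right {u : Plane × ℝ → ℝ} {g : Plane × ℝ → Grad}
    (h : HasWeakGradient u g) {φ : Plane × ℝ → ℝ} (hφ : ContDiff ℝ ∞ φ) (hc : HasCompactSupport φ)
    (hs : tsupport φ ⊆ halfSpace) (v : Grad) :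
    Integrable (fun p => inner ℝ (g p) v * φ p) halfMeasure :=
  integrable_mul (HasWeakGradient.inner_locInt h.locInt_grad v) hφ.continuous hc hs

lemma HasWeakGradient.congr {u u' : Plane × ℝ → ℝ} {g g' : Plane × ℝ → Grad}
    (h : HasWeakGradient u g) (hu : u =ᵐ[halfMeasure] u') (hg : g =ᵐ[halfMeasure] g') :
    HasWeakGradient u' g' := by
  refine ⟨?_, ?_, ?_⟩
  · intro x hx
    obtain ⟨U, hU, hi⟩ := h.locInt_fun x hx
    refine ⟨U ∩ halfSpace, inter_mem hU self_mem_nhdsWithin, ?_⟩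
    exact (hi.mono_set Set.inter_subset_left).congr
      (ae_mono (Measure.restrict_mono Set.inter_subset_right le_rfl) hu)
  · intro x hx
    obtain ⟨U, hU, hi⟩ := h.locInt_grad x hx
    refine ⟨U ∩ halfSpace, inter_mem hU self_mem_nhdsWithin, ?_⟩
    exact (hi.mono_set Set.inter_subset_left).congr
      (ae_mono (Measure.restrict_mono Set.inter_subset_right le_rfl) hg)
  · intro φ hφ hc hs v
    have e1 : ∫ p, u' p * fderiv ℝ φ p v ∂halfMeasure
        = ∫ p, u p * fderiv ℝ φ p v ∂halfMeasure :=
      integral_congr_ae (hu.mono fun p hp => by simp [hp])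
    have e2 : ∫ p, inner ℝ (g' p) (WithLp.toLp 2 v) * φ p ∂halfMeasure
        = ∫ p, inner ℝ (g p) (WithLp.toLp 2 v) * φ p ∂halfMeasure :=
      integral_congr_ae (hg.mono fun p hp => by simp only [hp])
    rw [e1, e2, h.byParts φ hφ hc hs v]

lemma HasWeakGradient.zero : HasWeakGradient 0 0 := by
  refine ⟨?_, ?_, ?_⟩
  · exact (locallyIntegrable_zero).locallyIntegrableOn _
  · exact (locallyIntegrable_zero).locallyIntegrableOn _
  · intro φ _ _ _ v
    simp

lemma HasWeakGradient.add {u u' : Plane × ℝ → ℝ} {g g' : Plane × ℝ → Grad}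
    (h : HasWeakGradient u g) (h' : HasWeakGradient u' g') :
    HasWeakGradient (u + u') (g + g') := by
  refine ⟨h.locInt_fun.add h'.locInt_fun, h.locInt_grad.add h'.locInt_grad, ?_⟩
  intro φ hφ hc hs v
  simp only [Pi.add_apply, inner_add_left, add_mul]
  rw [integral_add (h.integrable_left hφ hc hs v) (h'.integrable_left hφ hc hs v),
    integral_add (h.integrable_right hφ hc hs _) (h'.integrable_right hφ hc hs _),
    h.byParts φ hφ hc hs v, h'.byParts φ hφ hc hs v]
  ring

lemma HasWeakGradient.smul {u : Plane × ℝ → ℝ} {g : Plane × ℝ → Grad}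
    (h : HasWeakGradient u g) (c : ℝ) : HasWeakGradient (c • u) (c • g) := by
  refine ⟨?_, ?_, ?_⟩
  · intro x hx
    obtain ⟨U, hU, hi⟩ := h.locInt_fun x hx
    exact ⟨U, hU, Integrable.smul c hi⟩
  · intro x hx
    obtain ⟨U, hU, hi⟩ := h.locInt_grad x hx
    exact ⟨U, hU, Integrable.smul c hi⟩
  · intro φ hφ hc hs v
    simp only [Pi.smul_apply, inner_smul_left, smul_eq_mul, mul_assoc, integral_const_mul,
      h.byParts φ hφ hc hs v]
    simp

lemma halfMeasure_ac_gradMeasure (s : ℝ) : halfMeasure ≪ gradMeasure s := by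
  refine withDensity_absolutelyContinuous' ?_ ?_
  · exact (Measurable.ennreal_ofReal (by fun_prop)).aemeasurable
  · refine (ae_restrict_mem measurableSet_halfSpace).mono fun p hp => ?_
    exact (ENNReal.ofReal_pos.2 (Real.rpow_pos_of_pos hp _)).ne'

lemma halfMeasure_ac_potMeasure {V : Plane → ℝ} (hc : Continuous V) (hV : ∀ x, 0 < V x) (s : ℝ) :
    halfMeasure ≪ potMeasure V s := by
  refine withDensity_absolutelyContinuous' ?_ ?_
  · have := hc.measurable
    exact (Measurable.ennreal_ofReal (by fun_prop)).aemeasurable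
  · refine (ae_restrict_mem measurableSet_halfSpace).mono fun p hp => ?_
    exact (ENNReal.ofReal_pos.2 (mul_pos (hV _) (Real.rpow_pos_of_pos hp _))).ne'

/-- The extension space `H(ℝ³₊)` of `(-Δ + V)^s`: all `u ∈ L²(ℝ³₊)` with a weak gradient such that
`∬ (|∇u|² + V(x) u²) t^(1-2s) dx dt < ∞`. A function `u` is represented by the pair `(u, ∇u)`
(the weak gradient being unique), so that the norm which the space inherits from
`L²(V t^(1-2s) dx dt) × L²(t^(1-2s) dx dt)` is
`‖u‖² = ∬ (|∇u|² + V(x) u²) t^(1-2s) dx dt`. -/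
def extensionSpace (V : Plane → ℝ) (hc : Continuous V) (hV : ∀ x, 0 < V x) (s : ℝ) :
    Submodule ℝ (WithLp 2 (Lp ℝ 2 (potMeasure V s) × Lp Grad 2 (gradMeasure s))) where
  carrier := {z | MemLp z.fst 2 halfMeasure ∧ HasWeakGradient z.fst z.snd}
  zero_mem' := by
    have e1 := (halfMeasure_ac_potMeasure hc hV s).ae_eq (Lp.coeFn_zero ℝ 2 (potMeasure V s))
    have e2 := (halfMeasure_ac_gradMeasure s).ae_eq (Lp.coeFn_zero Grad 2 (gradMeasure s))
    exact ⟨(memLp_congr_ae e1).2 MemLp.zero', HasWeakGradient.zero.congr e1.symm e2.symm⟩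
  add_mem' := by
    rintro a b ⟨ha, ha'⟩ ⟨hb, hb'⟩
    have e1 := (halfMeasure_ac_potMeasure hc hV s).ae_eq (Lp.coeFn_add a.fst b.fst)
    have e2 := (halfMeasure_ac_gradMeasure s).ae_eq (Lp.coeFn_add a.snd b.snd)
    exact ⟨(memLp_congr_ae e1).2 (ha.add hb), (ha'.add hb').congr e1.symm e2.symm⟩
  smul_mem' := by
    rintro c a ⟨ha, ha'⟩
    have e1 := (halfMeasure_ac_potMeasure hc hV s).ae_eq (Lp.coeFn_smul c a.fst)
    have e2 := (halfMeasure_ac_gradMeasure s).ae_eq (Lp.coeFn_smul c a.snd)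
    exact ⟨(memLp_congr_ae e1).2 (ha.const_smul c), (ha'.smul c).congr e1.symm e2.symm⟩

/-- `f` is the trace on `ℝ² = ∂ℝ³₊` of `u`: `u(·, t) → f` in `L²(ℝ²)` as `t ↓ 0`. As `u` is
an almost-everywhere class on `ℝ³₊`, the slices `u(·, t)` make sense for almost every `t`, and
the limit is an essential limit (a null set of values of `t` is disregarded). -/
def IsTrace (u : Plane × ℝ → ℝ) (f : Plane → ℝ) : Prop :=
  Tendsto (fun t : ℝ => eLpNorm (fun x => u (x, t) - f x) 2 volume)
    (𝓝[>] (0 : ℝ) ⊓ ae (volume : Measure ℝ)) (𝓝 0)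

end SchrodingerExtension

end

/-! ### Weak gradients: the fundamental theorem of calculus along segments -/

namespace SchrodingerExtension

/-! The trace exists because the vertical derivative is integrable down to `t = 0`. Writing `|∂ₜu| =
t^(-(1-2s)/2) · t^((1-2s)/2) |∂ₜu|`, Cauchy–Schwarz bounds the squared L² distance of the slice at
height `t` from the trace by `t^(2s)/(2s)` times the weighted gradient energy
(`HasWeakGradient.exists_trace`). The rate depends on `u` only through this energy. Averaging over
the slab `1 < t ≤ 2` and using `V ≥ V₀` bounds the trace by the norm (`exists_trace_bound`).
Uniqueness of traces then makes the operator linear.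

For compactness, the trace is approximated in operator norm by averages of `u` against `w(y - x) δ⁻¹
1_(δ,2δ](t) dy dt`, where `w` is a bump of radius `η`. Such an average is Hilbert–Schmidt on `L²(V
t^(1-2s) dx dt)`: relative to that measure its kernel is `w(y - x) δ⁻¹ 1_(δ,2δ](t) / (V(y)
t^(1-2s))`, whose square norm is finite because `1/V` is integrable (`exists_average_operator`). The
error is controlled by the gradient energy alone: the vertical displacement costs a multiple of
`δ^(2s)`, the horizontal one `η²` times a constant depending on `δ` (`lintegral_sub_average_le`).
Choosing `δ` first and `η` afterwards makes the error small, and norm limits of compact operators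
are compact.

Both displacements rest on `HasWeakGradient.ae_sub_eq_integral`, which is proved by duality with
test functions, so neither smooth approximation nor an absolutely continuous representative is
needed. -/

lemma isOpen_halfSpace : IsOpen halfSpace := isOpen_lt continuous_const continuous_snd

instance : (volume : Measure (Plane × ℝ)).IsAddHaarMeasure :=
  inferInstanceAs ((volume : Measure Plane).prod (volume : Measure ℝ)).IsAddHaarMeasure

instance : SFinite halfMeasure := inferInstanceAs (SFinite (volume.restrict halfSpace))

lemma add_mem_halfSpace {p v : Plane × ℝ} (hp : p ∈ halfSpace) (hv : 0 ≤ v.2) :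
    p + v ∈ halfSpace := add_pos_of_pos_of_nonneg hp hv

lemma smul_snd_nonneg {v : Plane × ℝ} (hv : 0 ≤ v.2) {τ : ℝ} (hτ : 0 ≤ τ) : 0 ≤ (τ • v).2 :=
  mul_nonneg hτ hv

lemma measurePreserving_shear (v : Plane × ℝ) :
    MeasurePreserving (fun q : (Plane × ℝ) × ℝ => (q.1 + q.2 • v, q.2))
      (volume.prod volume) (volume.prod volume) := by
  have h := MeasurePreserving.skew_product (μa := (volume : Measure ℝ)) (μb := volume)
    (μc := (volume : Measure (Plane × ℝ))) (μd := volume) (f := id)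
    (g := fun τ p => p + τ • v) (MeasurePreserving.id _) (by fun_prop)
    (ae_of_all _ fun τ => map_add_right_eq_self _ _)
  exact Measure.measurePreserving_swap.comp (h.comp Measure.measurePreserving_swap)

/-- The segments `p + τ v` with `p ∈ K`, `τ ∈ [0, 1]` sweep out a compact subset of the half-space,
because `v` does not point downwards. The measure-preserving shear reduces the claim to
integrability on that set. -/
lemma integrableOn_shear {F : Type*} [NormedAddCommGroup F] {h : Plane × ℝ → F}
    (hh : LocallyIntegrableOn h halfSpace volume) {v : Plane × ℝ} (hv : 0 ≤ v.2)
    {K : Set (Plane × ℝ)} (hK : IsCompact K) (hKs : K ⊆ halfSpace) :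
    IntegrableOn (fun q : (Plane × ℝ) × ℝ => h (q.1 + q.2 • v)) (K ×ˢ Set.Icc 0 1)
      (volume.prod volume) := by
  have hK' : IsCompact ((fun q : (Plane × ℝ) × ℝ => q.1 + q.2 • v) '' (K ×ˢ Set.Icc 0 1)) :=
    (hK.prod isCompact_Icc).image (by fun_prop)
  set K' := (fun q : (Plane × ℝ) × ℝ => q.1 + q.2 • v) '' (K ×ˢ Set.Icc 0 1) with hK'def
  have hK's : K' ⊆ halfSpace := by
    rintro _ ⟨q, ⟨hq1, hq2⟩, rfl⟩
    exact add_mem_halfSpace (hKs hq1) (smul_snd_nonneg hv hq2.1)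
  have h1 : IntegrableOn (fun q : (Plane × ℝ) × ℝ => h q.1) (K' ×ˢ Set.Icc 0 1)
      (volume.prod volume) := by
    rw [IntegrableOn, ← Measure.prod_restrict]
    exact Integrable.comp_fst (hh.integrableOn_compact_subset hK's hK') _
  have hemb : MeasurableEmbedding (fun q : (Plane × ℝ) × ℝ => (q.1 + q.2 • v, q.2)) := by
    refine MeasurableEmbedding.of_measurable_inverse (g := fun q => (q.1 - q.2 • v, q.2))
      (by fun_prop) ?_ (by fun_prop) ?_
    · rw [Set.range_eq_univ.2]
      · exact MeasurableSet.univ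
      · intro q
        exact ⟨(q.1 - q.2 • v, q.2), by simp⟩
    · intro q
      simp
  refine (((measurePreserving_shear v).integrableOn_comp_preimage hemb).2 h1).mono_set ?_
  intro q hq
  exact ⟨⟨q, hq, rfl⟩, hq.2⟩

/-- Both integrands vanish off the half-space, since an upward shift keeps the support of `ψ`
inside. The integrals are therefore over the whole space, where Lebesgue measure is translation
invariant. -/
lemma integral_halfMeasure_mul_shift {h ψ : Plane × ℝ → ℝ} (hs : tsupport ψ ⊆ halfSpace)
    {v : Plane × ℝ} (hv : 0 ≤ v.2) :
    ∫ p, h p * ψ (p - v) ∂halfMeasure = ∫ p, h (p + v) * ψ p ∂halfMeasure := by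
  have hψ : ∀ p, p ∉ halfSpace → ψ p = 0 := fun p hp => image_eq_zero_of_notMem_tsupport
    fun h => hp (hs h)
  have e1 : ∫ p, h p * ψ (p - v) ∂halfMeasure = ∫ p, h p * ψ (p - v) := by
    refine setIntegral_eq_integral_of_forall_compl_eq_zero fun p hp => ?_
    rw [hψ, mul_zero]
    intro hp'
    exact hp (by simpa using add_mem_halfSpace hp' hv)
  have e2 : ∫ p, h (p + v) * ψ p ∂halfMeasure = ∫ p, h (p + v) * ψ p := by
    refine setIntegral_eq_integral_of_forall_compl_eq_zero fun p hp => ?_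
    rw [hψ p hp, mul_zero]
  rw [e1, e2, ← integral_add_right_eq_self (fun p => h p * ψ (p - v)) v]
  simp

lemma hasCompactSupport_shift {ψ : Plane × ℝ → ℝ} (hc : HasCompactSupport ψ) (v : Plane × ℝ) :
    HasCompactSupport fun p => ψ (p - v) := by
  simpa [Function.comp_def, sub_eq_add_neg] using
    hc.comp_homeomorph (Homeomorph.addRight (-v))

lemma tsupport_shift_subset {ψ : Plane × ℝ → ℝ} (hs : tsupport ψ ⊆ halfSpace) {v : Plane × ℝ}
    (hv : 0 ≤ v.2) : tsupport (fun p => ψ (p - v)) ⊆ halfSpace := by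
  intro p hp
  have h1 : p ∈ (fun p => p - v) ⁻¹' tsupport ψ :=
    tsupport_comp_subset_preimage ψ (f := fun p => p - v) (by fun_prop) hp
  simpa using add_mem_halfSpace (hs h1) hv

/-- The average of the directional derivative over a segment, tested against `φ`. -/
lemma HasWeakGradient.integral_diff_mul {u : Plane × ℝ → ℝ} {g : Plane × ℝ → Grad}
    (h : HasWeakGradient u g) {v : Plane × ℝ} (hv : 0 ≤ v.2) {φ : Plane × ℝ → ℝ}
    (hφ : ContDiff ℝ ∞ φ) (hc : HasCompactSupport φ) (hs : tsupport φ ⊆ halfSpace) :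
    ∫ p, u p * (φ (p - v) - φ p) ∂halfMeasure
      = ∫ p, (∫ τ in (0 : ℝ)..1, inner ℝ (g (p + τ • v)) (WithLp.toLp 2 v)) * φ p
          ∂halfMeasure := by
  have hcd : Continuous fun p => fderiv ℝ φ p v :=
    (hφ.continuous_fderiv (by simp)).clm_apply continuous_const
  have hFTC : ∀ p, φ (p - v) - φ p = ∫ τ in (0 : ℝ)..1, -fderiv ℝ φ (p - τ • v) v := by
    intro p
    rw [intervalIntegral.integral_eq_sub_of_hasDerivAt (f := fun τ : ℝ => φ (p - τ • v))]
    · simp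
    · intro τ _
      have h1 : HasFDerivAt φ (fderiv ℝ φ (p - τ • v)) (p - τ • v) :=
        (hφ.differentiable (by simp) _).hasFDerivAt
      have h2 : HasDerivAt (fun τ : ℝ => p - τ • v) (-v) τ := by
        simpa using ((hasDerivAt_id τ).smul_const v).const_sub p
      simpa [Function.comp_def] using h1.comp_hasDerivAt τ h2
    · exact (Continuous.neg (hcd.comp (by fun_prop))).intervalIntegrable _ _
  -- `K` contains the supports of all translates `φ(· - τ v)`, `τ ∈ [0, 1]`, so the first Fubini
  -- integrand vanishes off `K`.
  set K := (fun q : (Plane × ℝ) × ℝ => q.1 + q.2 • v) '' (tsupport φ ×ˢ Set.Icc 0 1) with hKdef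
  have hK : IsCompact K := (IsCompact.prod hc isCompact_Icc).image (by fun_prop)
  have hKs : K ⊆ halfSpace := by
    rintro _ ⟨q, ⟨hq1, hq2⟩, rfl⟩
    exact add_mem_halfSpace (hs hq1) (smul_snd_nonneg hv hq2.1)
  have hI1 : Integrable (Function.uncurry fun p (τ : ℝ) => u p * -fderiv ℝ φ (p - τ • v) v)
      (halfMeasure.prod (volume.restrict (Set.Ioc 0 1))) := by
    have h1 : IntegrableOn (fun q : (Plane × ℝ) × ℝ => u q.1) (K ×ˢ Set.Icc 0 1)
        (volume.prod volume) := by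
      rw [IntegrableOn, ← Measure.prod_restrict]
      exact Integrable.comp_fst (h.locInt_fun.integrableOn_compact_subset hKs hK) _
    have h2 : IntegrableOn (fun q : (Plane × ℝ) × ℝ => u q.1 * -fderiv ℝ φ (q.1 - q.2 • v) v)
        (K ×ˢ Set.Icc 0 1) (volume.prod volume) :=
      h1.mul_continuousOn
        (Continuous.neg (hcd.comp (by fun_prop : Continuous
          fun q : (Plane × ℝ) × ℝ => q.1 - q.2 • v))).continuousOn (hK.prod isCompact_Icc)
    rw [halfMeasure, Measure.prod_restrict]
    refine IntegrableOn.mono_set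
      (h2.of_forall_sdiff_eq_zero (t := Set.univ ×ˢ Set.Icc 0 1)
        (MeasurableSet.univ.prod measurableSet_Icc) ?_)
      (Set.prod_mono (Set.subset_univ _) Set.Ioc_subset_Icc_self)
    rintro ⟨p, τ⟩ ⟨⟨_, hτ⟩, hn⟩
    have : p - τ • v ∉ tsupport φ := fun hp =>
      hn ⟨⟨(p - τ • v, τ), ⟨hp, hτ⟩, by simp⟩, hτ⟩
    have h0 : fderiv ℝ φ (p - τ • v) = 0 :=
      image_eq_zero_of_notMem_tsupport fun hp => this (tsupport_fderiv_subset ℝ hp)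
    simp [h0]
  have hI2 : Integrable (Function.uncurry fun p (τ : ℝ) =>
      inner ℝ (g (p + τ • v)) (WithLp.toLp 2 v) * φ p)
      (halfMeasure.prod (volume.restrict (Set.Ioc 0 1))) := by
    have h1 := (integrableOn_shear h.locInt_grad hv hc hs).inner_const (𝕜 := ℝ)
      (WithLp.toLp 2 v : Grad)
    have h2 : IntegrableOn (fun q : (Plane × ℝ) × ℝ =>
        inner ℝ (g (q.1 + q.2 • v)) (WithLp.toLp 2 v) * φ q.1)
        (tsupport φ ×ˢ Set.Icc 0 1) (volume.prod volume) :=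
      IntegrableOn.mul_continuousOn h1 (hφ.continuous.comp continuous_fst).continuousOn
        (IsCompact.prod hc isCompact_Icc)
    rw [halfMeasure, Measure.prod_restrict]
    refine IntegrableOn.mono_set
      (h2.of_forall_sdiff_eq_zero (t := Set.univ ×ˢ Set.Icc 0 1)
        (MeasurableSet.univ.prod measurableSet_Icc) ?_)
      (Set.prod_mono (Set.subset_univ _) Set.Ioc_subset_Icc_self)
    rintro ⟨p, τ⟩ ⟨⟨_, hτ⟩, hn⟩
    have : p ∉ tsupport φ := fun hp => hn ⟨hp, hτ⟩
    simp [image_eq_zero_of_notMem_tsupport this]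
  calc ∫ p, u p * (φ (p - v) - φ p) ∂halfMeasure
      = ∫ p, (∫ τ in Set.Ioc (0 : ℝ) 1, u p * -fderiv ℝ φ (p - τ • v) v) ∂halfMeasure := by
        congr 1 with p
        rw [hFTC, intervalIntegral.integral_of_le zero_le_one, ← integral_const_mul]
    _ = ∫ τ in Set.Ioc (0 : ℝ) 1, ∫ p, u p * -fderiv ℝ φ (p - τ • v) v ∂halfMeasure :=
        integral_integral_swap hI1
    _ = ∫ τ in Set.Ioc (0 : ℝ) 1,
          ∫ p, inner ℝ (g (p + τ • v)) (WithLp.toLp 2 v) * φ p ∂halfMeasure := by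
        -- For each `τ` the weak derivative is tested against the translate `φ(· - τ v)`; the
        -- translation is then moved from `φ` onto `g`.
        refine setIntegral_congr_fun measurableSet_Ioc fun τ hτ => ?_
        have hv' := smul_snd_nonneg hv hτ.1.le
        have h1 := h.byParts (fun p => φ (p - τ • v)) (hφ.comp (by fun_prop))
          (hasCompactSupport_shift hc _) (tsupport_shift_subset hs hv') v
        have h2 : ∀ p, fderiv ℝ (fun p => φ (p - τ • v)) p v = fderiv ℝ φ (p - τ • v) v := by
          intro p
          rw [fderiv_comp_sub]
        simp only [h2] at h1
        simp only [mul_neg, integral_neg, h1, neg_neg]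
        exact integral_halfMeasure_mul_shift
          (h := fun p => inner ℝ (g p) (WithLp.toLp 2 v)) hs hv'
    _ = ∫ p, (∫ τ in Set.Ioc (0 : ℝ) 1, inner ℝ (g (p + τ • v)) (WithLp.toLp 2 v) * φ p)
          ∂halfMeasure := (integral_integral_swap hI2).symm
    _ = _ := by
        congr 1 with p
        rw [intervalIntegral.integral_of_le zero_le_one, integral_mul_const]

lemma LocallyIntegrableOn.shift {F : Type*} [NormedAddCommGroup F] {h : Plane × ℝ → F}
    (hh : LocallyIntegrableOn h halfSpace volume) {v : Plane × ℝ} (hv : 0 ≤ v.2) :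
    LocallyIntegrableOn (fun p => h (p + v)) halfSpace volume := by
  rw [locallyIntegrableOn_iff isOpen_halfSpace.isLocallyClosed] at hh ⊢
  intro K hKs hK
  have h1 := hh ((fun p => p + v) '' K) (by
    rintro _ ⟨p, hp, rfl⟩
    exact add_mem_halfSpace (hKs hp) hv) (hK.image (by fun_prop))
  refine (((measurePreserving_add_right volume v).integrableOn_comp_preimage
    (measurableEmbedding_addRight v)).2 h1).mono_set (Set.subset_preimage_image _ _)

/-- The fundamental theorem of calculus along segments for weakly differentiable functions. -/
lemma HasWeakGradient.ae_sub_eq_integral {u : Plane × ℝ → ℝ} {g : Plane × ℝ → Grad}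
    (h : HasWeakGradient u g) {v : Plane × ℝ} (hv : 0 ≤ v.2) :
    ∀ᵐ p ∂halfMeasure, u (p + v) - u p
      = ∫ τ in (0 : ℝ)..1, inner ℝ (g (p + τ • v)) (WithLp.toLp 2 v) := by
  have hu' := LocallyIntegrableOn.shift h.locInt_fun hv
  have hD : LocallyIntegrableOn
      (fun p => ∫ τ in (0 : ℝ)..1, inner ℝ (g (p + τ • v)) (WithLp.toLp 2 v)) halfSpace volume := by
    rw [locallyIntegrableOn_iff isOpen_halfSpace.isLocallyClosed]
    intro K hKs hK
    have h1 := (integrableOn_shear h.locInt_grad hv hK hKs).inner_const (𝕜 := ℝ)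
      (WithLp.toLp 2 v : Grad)
    have h2 := IntegrableOn.mono_set h1 (Set.prod_mono (Set.Subset.refl K) Set.Ioc_subset_Icc_self)
    rw [IntegrableOn, ← Measure.prod_restrict] at h2
    have h3 := h2.integral_prod_left
    simp only [intervalIntegral.integral_of_le zero_le_one]
    exact h3
  -- The fundamental lemma of the calculus of variations, applied to the difference of the two
  -- sides.
  have key := isOpen_halfSpace.ae_eq_zero_of_integral_contDiff_smul_eq_zero (μ := volume)
    (f := fun p => (u (p + v) - u p)
      - ∫ τ in (0 : ℝ)..1, inner ℝ (g (p + τ • v)) (WithLp.toLp 2 v))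
    ((hu'.sub h.locInt_fun).sub hD) ?_
  · rw [halfMeasure, ae_restrict_iff' measurableSet_halfSpace]
    filter_upwards [key] with p hp hps
    exact sub_eq_zero.1 (hp hps)
  intro φ hφ hc hs
  have e0 : ∫ p, φ p • ((u (p + v) - u p)
      - ∫ τ in (0 : ℝ)..1, inner ℝ (g (p + τ • v)) (WithLp.toLp 2 v))
      = ∫ p, φ p • ((u (p + v) - u p)
      - ∫ τ in (0 : ℝ)..1, inner ℝ (g (p + τ • v)) (WithLp.toLp 2 v)) ∂halfMeasure := by
    refine (setIntegral_eq_integral_of_forall_compl_eq_zero fun p hp => ?_).symm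
    rw [image_eq_zero_of_notMem_tsupport fun h => hp (hs h), zero_smul]
  have i1 := integrable_mul hu' hφ.continuous hc hs
  have i2 := integrable_mul h.locInt_fun hφ.continuous hc hs
  have i3 := integrable_mul hD hφ.continuous hc hs
  have i4 := integrable_mul h.locInt_fun (hφ.continuous.comp (by fun_prop :
    Continuous fun p : Plane × ℝ => p - v)) (hasCompactSupport_shift hc v)
    (tsupport_shift_subset hs hv)
  have e1 := h.integral_diff_mul hv hφ hc hs
  simp only [mul_sub] at e1
  simp only [Function.comp_def] at i4
  rw [integral_sub i4 i2] at e1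
  have e2 := integral_halfMeasure_mul_shift (h := u) hs hv
  have e3 : ∫ p, φ p • ((u (p + v) - u p)
      - ∫ τ in (0 : ℝ)..1, inner ℝ (g (p + τ • v)) (WithLp.toLp 2 v)) ∂halfMeasure
      = ∫ p, ((u (p + v) * φ p - u p * φ p)
      - (∫ τ in (0 : ℝ)..1, inner ℝ (g (p + τ • v)) (WithLp.toLp 2 v)) * φ p) ∂halfMeasure := by
    congr 1 with p
    simp only [smul_eq_mul]
    ring
  rw [e0, e3, integral_sub (by exact i1.sub i2) i3, integral_sub i1 i2]
  linarith

end SchrodingerExtension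

/-! ### Slices and existence of the trace -/

namespace SchrodingerExtension

lemma halfMeasure_eq_prod :
    halfMeasure = (volume : Measure Plane).prod (volume.restrict (Set.Ioi (0 : ℝ))) := by
  have h : halfSpace = (Set.univ : Set Plane) ×ˢ Set.Ioi (0 : ℝ) := by
    ext p
    simp [halfSpace]
  rw [halfMeasure, h, ← Measure.restrict_univ (μ := (volume : Measure Plane)),
    Measure.prod_restrict]
  rfl

lemma ae_halfMeasure_iff {P : Plane → ℝ → Prop} (hP : MeasurableSet {p : Plane × ℝ | P p.1 p.2}) :
    (∀ᵐ p ∂halfMeasure, P p.1 p.2) ↔ ∀ᵐ t ∂volume.restrict (Set.Ioi (0 : ℝ)), ∀ᵐ x, P x t := by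
  rw [halfMeasure_eq_prod, Measure.ae_prod_iff_ae_ae hP, Measure.ae_ae_comm hP]

lemma measurableSet_setOf_ae {α β : Type*} [MeasurableSpace α] [MeasurableSpace β] {ν : Measure β}
    [SFinite ν] {M : Set (α × β)} (hM : MeasurableSet M) :
    MeasurableSet {a | ∀ᵐ b ∂ν, (a, b) ∈ M} :=
  measurable_measure_prodMk_left hM.compl (measurableSet_singleton 0)

/-- The map `(t, t') ↦ (t, t' - t)` preserves planar measure. A property of a height and an
increment, known for each fixed increment, thereby becomes a property of almost every pair of
heights. -/
lemma ae_prod_shift {R : ℝ → ℝ → Prop} (hm : MeasurableSet {z : ℝ × ℝ | R z.1 z.2})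
    (hR : ∀ h, 0 < h → ∀ᵐ t ∂volume.restrict (Set.Ioi (0 : ℝ)), R t h) :
    ∀ᵐ z : ℝ × ℝ ∂volume.prod volume, 0 < z.1 → z.1 < z.2 → R z.1 (z.2 - z.1) := by
  have hm' : MeasurableSet {z : ℝ × ℝ | 0 < z.1 → 0 < z.2 → R z.1 z.2} := by
    simp only [imp_iff_not_or, Set.ofPred_or]
    exact (measurableSet_lt measurable_const measurable_fst).compl.union
      ((measurableSet_lt measurable_const measurable_snd).compl.union hm)
  have h1 : ∀ᵐ z : ℝ × ℝ ∂volume.prod volume, 0 < z.1 → 0 < z.2 → R z.1 z.2 := by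
    rw [Measure.ae_prod_iff_ae_ae hm',
      Measure.ae_ae_comm (p := fun t h => 0 < t → 0 < h → R t h) hm']
    refine ae_of_all _ fun h => ?_
    by_cases hh : 0 < h
    · filter_upwards [(ae_restrict_iff' measurableSet_Ioi).1 (hR h hh)] with t ht ht0 _
      exact ht ht0
    · exact ae_of_all _ fun t _ h0 => absurd h0 hh
  filter_upwards [(measurePreserving_prod_sub (volume : Measure ℝ)
    (volume : Measure ℝ)).quasiMeasurePreserving.ae h1] with z hz h0 hlt
  exact hz h0 (sub_pos.2 hlt)

/-- Slices of a weakly differentiable function: for a suitable height `t₀`, almost every slice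
differs from the slice at height `t₀` by the integral of the vertical derivative. -/
lemma HasWeakGradient.exists_slice {u : Plane × ℝ → ℝ} {g : Plane × ℝ → Grad}
    (h : HasWeakGradient u g) (hu : StronglyMeasurable u) (hg : StronglyMeasurable g) :
    ∃ t₀ : ℝ, 0 < t₀ ∧ ∀ᵐ t ∂volume.restrict (Set.Ioi (0 : ℝ)), ∀ᵐ x,
      u (x, t) - u (x, t₀) = ∫ σ in t₀..t, (g (x, σ)).snd := by
  set Q : ℝ × ℝ → Plane → Prop := fun z x =>
    u (x, z.1 + z.2) - u (x, z.1)
      = ∫ τ in Set.Ioc (0 : ℝ) 1, z.2 * (g (x, z.1 + z.2 * τ)).snd with hQ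
  have hint : StronglyMeasurable fun q : (ℝ × ℝ) × Plane =>
      ∫ τ in Set.Ioc (0 : ℝ) 1, q.1.2 * (g (q.2, q.1.1 + q.1.2 * τ)).snd := by
    refine StronglyMeasurable.integral_prod_right
      (f := fun (q : (ℝ × ℝ) × Plane) (τ : ℝ) => q.1.2 * (g (q.2, q.1.1 + q.1.2 * τ)).snd) ?_
    have h1 : StronglyMeasurable fun r : ((ℝ × ℝ) × Plane) × ℝ =>
        g (r.1.2, r.1.1.1 + r.1.1.2 * r.2) := hg.comp_measurable (by fun_prop)
    have h2 : StronglyMeasurable fun r : ((ℝ × ℝ) × Plane) × ℝ =>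
        (g (r.1.2, r.1.1.1 + r.1.1.2 * r.2)).snd :=
      (WithLp.sndL 2 ℝ Plane ℝ).continuous.comp_stronglyMeasurable h1
    exact StronglyMeasurable.mul (by fun_prop) h2
  have hM : MeasurableSet {q : (ℝ × ℝ) × Plane | Q q.1 q.2} :=
    ((hu.comp_measurable (by fun_prop :
      Measurable fun q : (ℝ × ℝ) × Plane => (q.2, q.1.1 + q.1.2))).sub
      (hu.comp_measurable (by fun_prop :
        Measurable fun q : (ℝ × ℝ) × Plane => (q.2, q.1.1)))).measurableSet_eq_fun hint
  have h1 : ∀ r, 0 < r → ∀ᵐ t ∂volume.restrict (Set.Ioi (0 : ℝ)), ∀ᵐ x, Q (t, r) x := by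
    intro r hr
    rw [← ae_halfMeasure_iff (P := fun x t => Q (t, r) x)
      (hM.preimage (by fun_prop : Measurable fun p : Plane × ℝ => ((p.2, r), p.1)))]
    filter_upwards [h.ae_sub_eq_integral (v := (0, r)) hr.le] with p hp
    rw [intervalIntegral.integral_of_le zero_le_one] at hp
    simpa [hQ, mul_comm, Prod.add_def] using hp
  have h2 := ae_prod_shift (R := fun t r => ∀ᵐ x, Q (t, r) x) (measurableSet_setOf_ae hM) h1
  -- The swapped statement covers the heights `t` below `t₀`.
  have h3 := Measure.measurePreserving_swap (μ := (volume : Measure ℝ))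
    (ν := (volume : Measure ℝ)) |>.quasiMeasurePreserving.ae h2
  have h4 : ∀ᵐ t₀ ∂volume.restrict (Set.Ioi (0 : ℝ)), ∀ᵐ t : ℝ,
      (0 < t₀ → t₀ < t → ∀ᵐ x, Q (t₀, t - t₀) x) ∧ (0 < t → t < t₀ → ∀ᵐ x, Q (t, t₀ - t) x) :=
    ae_restrict_of_ae (Measure.ae_ae_of_ae_prod (h2.and h3))
  have hne : (ae (volume.restrict (Set.Ioi (0 : ℝ)))).NeBot := by
    rw [ae_neBot, Ne, Measure.restrict_eq_zero]
    simp
  -- Substitution `σ = t + r τ` in the integral over the unit interval.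
  have hQ' : ∀ t r x, Q (t, r) x →
      u (x, t + r) - u (x, t) = ∫ σ in t..(t + r), (g (x, σ)).snd := by
    intro t r x hx
    have h5 := intervalIntegral.smul_integral_comp_add_mul (a := 0) (b := 1)
      (fun σ => (g (x, σ)).snd) r t
    rw [intervalIntegral.integral_of_le zero_le_one, smul_eq_mul, ← integral_const_mul] at h5
    simp only [mul_zero, add_zero, mul_one] at h5
    rw [← h5]
    exact hx
  -- By Fubini almost every height is a valid base point, and the positive half-line is not a null
  -- set.
  obtain ⟨t₀, ht₀, h0⟩ := (h4.and (ae_restrict_mem measurableSet_Ioi)).exists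
  refine ⟨t₀, h0, ?_⟩
  rw [ae_restrict_iff' measurableSet_Ioi]
  filter_upwards [ht₀] with t ht htpos
  rcases lt_trichotomy t₀ t with hlt | rfl | hlt
  · filter_upwards [ht.1 h0 hlt] with x hx
    simpa using hQ' _ _ _ hx
  · simp
  · filter_upwards [ht.2 htpos hlt] with x hx
    have := hQ' _ _ _ hx
    rw [add_sub_cancel] at this
    rw [intervalIntegral.integral_symm, ← this]
    ring

lemma sq_lintegral_mul_le {α : Type*} [MeasurableSpace α] {μ : Measure α} {f g : α → ENNReal}
    (hf : AEMeasurable f μ) (hg : AEMeasurable g μ) :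
    (∫⁻ a, f a * g a ∂μ) ^ 2 ≤ (∫⁻ a, f a ^ 2 ∂μ) * ∫⁻ a, g a ^ 2 ∂μ := by
  have h := ENNReal.lintegral_mul_le_Lp_mul_Lq μ Real.HolderConjugate.two_two hf hg
  have h2 := pow_le_pow_left₀ (zero_le (a := _)) h 2
  rw [mul_pow, ← ENNReal.rpow_natCast, ← ENNReal.rpow_natCast, ← ENNReal.rpow_natCast,
    ← ENNReal.rpow_mul, ← ENNReal.rpow_mul] at h2
  simpa [ENNReal.rpow_ofNat] using h2

lemma lintegral_rpow_Ioc {s t : ℝ} (hs : 0 < s) (ht : 0 < t) :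
    ∫⁻ σ in Set.Ioc 0 t, ENNReal.ofReal (σ ^ (-(1 - 2 * s)))
      = ENNReal.ofReal (t ^ (2 * s) / (2 * s)) := by
  have hi : IntegrableOn (fun σ : ℝ => σ ^ (-(1 - 2 * s))) (Set.Ioc 0 t) := by
    rw [← intervalIntegrable_iff_integrableOn_Ioc_of_le ht.le]
    exact intervalIntegral.intervalIntegrable_rpow' (by linarith)
  rw [← ofReal_integral_eq_lintegral_ofReal hi, ← intervalIntegral.integral_of_le ht.le,
    integral_rpow (Or.inl (by linarith))]
  · rw [show -(1 - 2 * s) + 1 = 2 * s by ring, Real.zero_rpow (by positivity), sub_zero]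
  · filter_upwards [ae_restrict_mem measurableSet_Ioc] with σ hσ
    exact Real.rpow_nonneg hσ.1.le _

/-- Cauchy–Schwarz after splitting off `σ^(-(1-2s)/2)`. The square of this factor is integrable at
`0` exactly because `s > 0`, and its integral is the rate `t^(2s)/(2s)`. -/
lemma sq_lintegral_Ioc_le {s t : ℝ} (hs : 0 < s) (ht : 0 < t) {φ : ℝ → ENNReal}
    (hφ : Measurable φ) :
    (∫⁻ σ in Set.Ioc 0 t, φ σ) ^ 2 ≤ ENNReal.ofReal (t ^ (2 * s) / (2 * s))
      * ∫⁻ σ in Set.Ioi 0, φ σ ^ 2 * ENNReal.ofReal (σ ^ (1 - 2 * s)) := by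
  have e1 : ∫⁻ σ in Set.Ioc 0 t, φ σ
      = ∫⁻ σ in Set.Ioc 0 t, ENNReal.ofReal (σ ^ (-((1 - 2 * s) / 2)))
        * (φ σ * ENNReal.ofReal (σ ^ ((1 - 2 * s) / 2))) := by
    refine setLIntegral_congr_fun measurableSet_Ioc fun σ hσ => ?_
    have h1 : ENNReal.ofReal (σ ^ (-((1 - 2 * s) / 2))) * ENNReal.ofReal (σ ^ ((1 - 2 * s) / 2))
        = 1 := by
      rw [← ENNReal.ofReal_mul (Real.rpow_nonneg hσ.1.le _), ← Real.rpow_add hσ.1]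
      simp
    rw [mul_left_comm, h1, mul_one]
  have hsq : ∀ b : ℝ, ∀ σ ∈ Set.Ioi (0 : ℝ), ENNReal.ofReal (σ ^ (b / 2)) ^ 2
      = ENNReal.ofReal (σ ^ b) := by
    intro b σ hσ
    rw [← ENNReal.ofReal_pow (Real.rpow_nonneg (le_of_lt hσ) _), ← Real.rpow_natCast,
      ← Real.rpow_mul (le_of_lt hσ)]
    congr 2
    push_cast
    ring
  rw [e1]
  refine (sq_lintegral_mul_le (by fun_prop) (by fun_prop)).trans ?_
  gcongr ?_ * ?_
  · rw [← lintegral_rpow_Ioc hs ht]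
    refine (setLIntegral_congr_fun measurableSet_Ioc fun σ hσ => ?_).le
    have h1 := hsq (-(1 - 2 * s)) σ hσ.1
    rwa [neg_div] at h1
  · calc ∫⁻ σ in Set.Ioc 0 t, (φ σ * ENNReal.ofReal (σ ^ ((1 - 2 * s) / 2))) ^ 2
        = ∫⁻ σ in Set.Ioc 0 t, φ σ ^ 2 * ENNReal.ofReal (σ ^ (1 - 2 * s)) :=
          setLIntegral_congr_fun measurableSet_Ioc fun σ hσ => by
            simp only [mul_pow, hsq _ σ hσ.1]
      _ ≤ _ := lintegral_mono_set Set.Ioc_subset_Ioi_self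

lemma lintegral_gradMeasure {s : ℝ} {f : Plane × ℝ → ENNReal} (hf : Measurable f) :
    ∫⁻ p, f p ∂gradMeasure s
      = ∫⁻ x, ∫⁻ t in Set.Ioi 0, f (x, t) * ENNReal.ofReal (t ^ (1 - 2 * s)) := by
  have hm : Measurable fun p : Plane × ℝ => ENNReal.ofReal (p.2 ^ (1 - 2 * s)) := by fun_prop
  rw [gradMeasure, lintegral_withDensity_eq_lintegral_mul _ hm hf, halfMeasure_eq_prod,
    lintegral_prod _ (hm.mul hf).aemeasurable]
  simp [mul_comm]

lemma norm_snd_le (v : Grad) : ‖v.snd‖ ≤ ‖v‖ := by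
  rw [WithLp.prod_norm_eq_of_L2]
  exact Real.le_sqrt_of_sq_le (le_add_of_nonneg_left (sq_nonneg _))

/-- Existence of the trace, with the rate of convergence of the slices. -/
lemma HasWeakGradient.exists_trace {s : ℝ} (hs : 0 < s) {u : Plane × ℝ → ℝ} {g : Plane × ℝ → Grad}
    (h : HasWeakGradient u g) (hu : StronglyMeasurable u) (hg : StronglyMeasurable g)
    (hfin : ∫⁻ p, ‖g p‖ₑ ^ 2 ∂gradMeasure s ≠ ⊤) :
    ∃ f : Plane → ℝ, StronglyMeasurable f ∧ ∀ᵐ t ∂volume.restrict (Set.Ioi (0 : ℝ)),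
      ∫⁻ x, ‖u (x, t) - f x‖ₑ ^ 2
        ≤ ENNReal.ofReal (t ^ (2 * s) / (2 * s)) * ∫⁻ p, ‖g p‖ₑ ^ 2 ∂gradMeasure s := by
  obtain ⟨t₀, ht₀, hsl⟩ := h.exists_slice hu hg
  have hg3 : StronglyMeasurable fun p => (g p).snd :=
    (WithLp.sndL 2 ℝ Plane ℝ).continuous.comp_stronglyMeasurable hg
  have hgm : Measurable fun p => ‖g p‖ₑ := hg.enorm
  rw [lintegral_gradMeasure (hgm.pow_const 2)] at hfin ⊢
  have hGm : Measurable fun x : Plane => ∫⁻ t in Set.Ioi (0 : ℝ),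
      ‖g (x, t)‖ₑ ^ 2 * ENNReal.ofReal (t ^ (1 - 2 * s)) := by
    refine Measurable.lintegral_prod_right'
      (f := fun p : Plane × ℝ => ‖g p‖ₑ ^ 2 * ENNReal.ofReal (p.2 ^ (1 - 2 * s))) ?_
    fun_prop
  have hGfin := ae_lt_top hGm hfin
  set G := fun x : Plane => ∫⁻ t in Set.Ioi (0 : ℝ),
      ‖g (x, t)‖ₑ ^ 2 * ENNReal.ofReal (t ^ (1 - 2 * s)) with hG
  have hbound : ∀ x t, 0 < t → (∫⁻ σ in Set.Ioc 0 t, ‖g (x, σ)‖ₑ) ^ 2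
      ≤ ENNReal.ofReal (t ^ (2 * s) / (2 * s)) * G x := fun x t ht =>
    sq_lintegral_Ioc_le hs ht (hgm.comp measurable_prodMk_left)
  have hle : ∀ x t, ∫⁻ σ in Set.Ioc 0 t, ‖(g (x, σ)).snd‖ₑ ≤ ∫⁻ σ in Set.Ioc 0 t, ‖g (x, σ)‖ₑ :=
    fun x t => lintegral_mono fun σ => enorm_le_iff_norm_le.2 (norm_snd_le _)
  -- Finite weighted energy on the vertical line over `x` makes the unweighted vertical derivative
  -- integrable down to the boundary.
  have hint : ∀ x, G x < ⊤ → ∀ t, 0 < t →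
      IntervalIntegrable (fun σ => (g (x, σ)).snd) volume 0 t := by
    intro x hx t ht
    rw [intervalIntegrable_iff_integrableOn_Ioc_of_le ht.le]
    refine ⟨(hg3.comp_measurable measurable_prodMk_left).aestronglyMeasurable,
      (hle x t).trans_lt ?_⟩
    have h1 : (∫⁻ σ in Set.Ioc 0 t, ‖g (x, σ)‖ₑ) ^ 2 < ⊤ :=
      (hbound x t ht).trans_lt (ENNReal.mul_lt_top ENNReal.ofReal_lt_top hx)
    by_contra hcon
    rw [not_lt, top_le_iff] at hcon
    simp [hcon] at h1
  -- The trace is obtained by following the vertical derivative from the base height `t₀` down to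
  -- `0`.
  refine ⟨fun x => u (x, t₀) - ∫ σ in Set.Ioc 0 t₀, (g (x, σ)).snd, ?_, ?_⟩
  · exact (hu.comp_measurable (by fun_prop)).sub
      (StronglyMeasurable.integral_prod_right (f := fun x σ => (g (x, σ)).snd) hg3)
  filter_upwards [hsl, ae_restrict_mem measurableSet_Ioi] with t ht htpos
  calc _ ≤ ∫⁻ x, ENNReal.ofReal (t ^ (2 * s) / (2 * s)) * G x := by
        refine lintegral_mono_ae ?_
        filter_upwards [ht, hGfin] with x hx hxfin
        have e1 : u (x, t) - (u (x, t₀) - ∫ σ in Set.Ioc 0 t₀, (g (x, σ)).snd)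
            = ∫ σ in Set.Ioc 0 t, (g (x, σ)).snd := by
          rw [← intervalIntegral.integral_interval_sub_left
            (hint x hxfin t htpos) (hint x hxfin t₀ ht₀)] at hx
          rw [← intervalIntegral.integral_of_le ht₀.le,
            ← intervalIntegral.integral_of_le (le_of_lt htpos)]
          linarith
        rw [e1]
        refine le_trans ?_ (hbound x t htpos)
        gcongr
        exact (enorm_integral_le_lintegral_enorm _).trans (hle x t)
    _ = _ := lintegral_const_mul _ hGm

end SchrodingerExtension

/-! ### Hilbert–Schmidt operators are compact -/

namespace SchrodingerExtension

/-- The Hilbert–Schmidt operator `u ↦ (x ↦ ⟪u, k x⟫)` attached to a square integrable family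
`k` of vectors, as a bounded bilinear map in `(k, u)`. -/
noncomputable def hilbertSchmidt {X E : Type*} [MeasurableSpace X] [NormedAddCommGroup E]
    [InnerProductSpace ℝ E] (μ : Measure X) : Lp E 2 μ →L[ℝ] E →L[ℝ] Lp ℝ 2 μ :=
  LinearMap.mkContinuous₂
    (LinearMap.mk₂ ℝ (fun (k : Lp E 2 μ) (u : E) => (innerSL ℝ u).compLp k)
      (fun k k' u => map_add (ContinuousLinearMap.compLpL 2 μ (innerSL ℝ u)) k k')
      (fun c k u => map_smul (ContinuousLinearMap.compLpL 2 μ (innerSL ℝ u)) c k)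
      (fun k u u' => by rw [map_add, ContinuousLinearMap.add_compLp])
      (fun c k u => by
        rw [map_smul]
        exact ContinuousLinearMap.smul_compLp c (innerSL ℝ u) k))
    1
    (fun k u => by
      refine (ContinuousLinearMap.norm_compLp_le _ _).trans ?_
      rw [innerSL_apply_norm, one_mul, mul_comm])

lemma coeFn_hilbertSchmidt {X E : Type*} [MeasurableSpace X] [NormedAddCommGroup E]
    [InnerProductSpace ℝ E] {μ : Measure X} (k : Lp E 2 μ) (u : E) :
    hilbertSchmidt μ k u =ᵐ[μ] fun x => inner ℝ u (k x) :=
  ContinuousLinearMap.coeFn_compLp (innerSL ℝ u) k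

/-- An indicator kernel gives an operator of rank at most one, sums preserve compactness, and the
operator depends continuously on `k` in operator norm. Density of simple functions and closedness of
the compact operators finish the argument. -/
lemma isCompactOperator_hilbertSchmidt {X E : Type*} [MeasurableSpace X] [NormedAddCommGroup E]
    [InnerProductSpace ℝ E] {μ : Measure X} (k : Lp E 2 μ) :
    IsCompactOperator (hilbertSchmidt μ k) := by
  induction k using Lp.induction (p := 2) (ENNReal.ofNat_ne_top) with
  | indicatorConst c hs hμs =>
    have h : ∀ u : E, hilbertSchmidt μ ((Lp.simpleFunc.indicatorConst 2 hs hμs.ne c : Lp E 2 μ)) u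
        = (innerSL ℝ c).smulRight (indicatorConstLp 2 hs hμs.ne (1 : ℝ)) u := by
      intro u
      rw [Lp.simpleFunc.coe_indicatorConst]
      apply Lp.ext
      filter_upwards [coeFn_hilbertSchmidt (indicatorConstLp 2 hs hμs.ne c) u,
        indicatorConstLp_coeFn (p := 2) (hs := hs) (hμs := hμs.ne) (c := c),
        indicatorConstLp_coeFn (p := 2) (hs := hs) (hμs := hμs.ne) (c := (1 : ℝ)),
        Lp.coeFn_smul (inner ℝ c u) (indicatorConstLp 2 hs hμs.ne (1 : ℝ))] with x h1 h2 h3 h4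
      rw [h1, h2, ContinuousLinearMap.smulRight_apply, innerSL_apply_apply, h4, Pi.smul_apply, h3]
      rename_i s
      by_cases hx : x ∈ s <;> simp [hx, real_inner_comm]
    rw [ContinuousLinearMap.ext h]
    have hid : IsCompactOperator (ContinuousLinearMap.id ℝ ℝ) := by
      refine ⟨Metric.closedBall 0 1, isCompact_closedBall _ _, ?_⟩
      simpa using Metric.closedBall_mem_nhds (0 : ℝ) one_pos
    exact (hid.clm_comp
      (ContinuousLinearMap.toSpanSingleton ℝ (indicatorConstLp 2 hs hμs.ne (1 : ℝ)))).comp_clm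
        (innerSL ℝ c)
  | add hf hg _ ihf ihg =>
    rw [map_add]
    exact ihf.add ihg
  | isClosed =>
    exact isClosed_setOfPred_isCompactOperator.preimage (hilbertSchmidt μ).continuous

end SchrodingerExtension

/-! ### Slab estimates; uniqueness and linearity of traces -/

namespace SchrodingerExtension

lemma lintegral_potMeasure {V : Plane → ℝ} (hVc : Continuous V) {s : ℝ} {f : Plane × ℝ → ENNReal}
    (hf : Measurable f) : ∫⁻ p, f p ∂potMeasure V s
      = ∫⁻ p, f p * ENNReal.ofReal (V p.1 * p.2 ^ (1 - 2 * s)) ∂halfMeasure := by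
  have hVm := hVc.measurable
  have hm : Measurable fun p : Plane × ℝ => ENNReal.ofReal (V p.1 * p.2 ^ (1 - 2 * s)) := by
    fun_prop
  rw [potMeasure, lintegral_withDensity_eq_lintegral_mul _ hm hf]
  simp [mul_comm]

lemma lintegral_gradMeasure_le {V : Plane → ℝ} (hVc : Continuous V) {V₀ : ℝ} (hV₀ : 0 < V₀)
    (hV : ∀ x, V₀ ≤ V x) {s : ℝ} {f : Plane × ℝ → ENNReal} (hf : Measurable f) :
    ∫⁻ p, f p ∂gradMeasure s ≤ ENNReal.ofReal V₀⁻¹ * ∫⁻ p, f p ∂potMeasure V s := by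
  have hVm := hVc.measurable
  have hm : Measurable fun p : Plane × ℝ => ENNReal.ofReal (p.2 ^ (1 - 2 * s)) := by fun_prop
  rw [lintegral_potMeasure hVc hf, gradMeasure, lintegral_withDensity_eq_lintegral_mul _ hm hf,
    ← lintegral_const_mul _ (by fun_prop)]
  refine lintegral_mono_ae ?_
  filter_upwards [ae_restrict_mem measurableSet_halfSpace] with p hp
  have hp' : 0 ≤ p.2 ^ (1 - 2 * s) := Real.rpow_nonneg (le_of_lt hp) _
  rw [Pi.mul_apply, mul_comm, mul_left_comm, ← ENNReal.ofReal_mul (inv_pos.2 hV₀).le]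
  gcongr
  rw [← mul_assoc]
  refine le_mul_of_one_le_left hp' ?_
  rw [inv_mul_eq_div, one_le_div hV₀]
  exact hV _

/-- The exponent may have either sign, so the minimum comes from compactness of `[δ, 2δ]` instead of
from a chosen endpoint. -/
lemma exists_le_rpow {δ : ℝ} (hδ : 0 < δ) (b : ℝ) :
    ∃ c : ℝ, 0 < c ∧ ∀ t ∈ Set.Ioc δ (2 * δ), c ≤ t ^ b := by
  have hcont : ContinuousOn (fun t : ℝ => t ^ b) (Set.Icc δ (2 * δ)) := fun t ht =>
    (Real.continuousAt_rpow_const _ _ (Or.inl (hδ.trans_le ht.1).ne')).continuousWithinAt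
  obtain ⟨t₀, ht₀, hmin⟩ := isCompact_Icc.exists_isMinOn
    (Set.nonempty_Icc.2 (by linarith : δ ≤ 2 * δ)) hcont
  exact ⟨t₀ ^ b, Real.rpow_pos_of_pos (hδ.trans_le ht₀.1) _,
    fun t ht => hmin (Set.Ioc_subset_Icc_self ht)⟩

lemma lintegral_slab_le {δ : ℝ} (hδ : 0 < δ) {s c : ℝ} (hc : 0 < c)
    (hcle : ∀ t ∈ Set.Ioc δ (2 * δ), c ≤ t ^ (1 - 2 * s)) {f : Plane × ℝ → ENNReal}
    (hf : Measurable f) : ∫⁻ t in Set.Ioc δ (2 * δ), ∫⁻ x, f (x, t)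
      ≤ ENNReal.ofReal c⁻¹ * ∫⁻ p, f p ∂gradMeasure s := by
  have hm : Measurable fun p : Plane × ℝ => f p * ENNReal.ofReal (p.2 ^ (1 - 2 * s)) := by
    fun_prop
  have hmx : ∀ t : ℝ, Measurable fun x => f (x, t) := fun t => hf.comp (by fun_prop)
  rw [lintegral_gradMeasure hf,
    lintegral_lintegral_swap (f := fun x t => f (x, t) * ENNReal.ofReal (t ^ (1 - 2 * s)))
      hm.aemeasurable, ← lintegral_const_mul _ (by
        exact Measurable.lintegral_prod_left' (f := fun p : Plane × ℝ =>
          f p * ENNReal.ofReal (p.2 ^ (1 - 2 * s))) hm)]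
  refine le_trans ?_ (lintegral_mono_set
    (fun t ht => hδ.trans ht.1 : Set.Ioc δ (2 * δ) ⊆ Set.Ioi 0))
  refine lintegral_mono_ae ?_
  filter_upwards [ae_restrict_mem measurableSet_Ioc] with t ht
  rw [lintegral_mul_const _ (hmx t), mul_left_comm, ← ENNReal.ofReal_mul (inv_pos.2 hc).le]
  refine le_mul_of_one_le_right' ?_
  rw [ENNReal.one_le_ofReal, inv_mul_eq_div, one_le_div hc]
  exact hcle t ht

lemma enorm_sub_sq_le (a b c : ℝ) : ‖a - c‖ₑ ^ 2 ≤ 2 * ‖a - b‖ₑ ^ 2 + 2 * ‖b - c‖ₑ ^ 2 := by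
  have h : ‖a - c‖ₑ ≤ ‖a - b‖ₑ + ‖b - c‖ₑ := by
    simpa using enorm_add_le (a - b) (b - c)
  refine (pow_le_pow_left₀ (zero_le (a := _)) h 2).trans ?_
  have h2 := ENNReal.rpow_add_le_mul_rpow_add_rpow ‖a - b‖ₑ ‖b - c‖ₑ one_le_two
  rw [← mul_add]
  norm_num at h2
  exact h2

/-- The norm of `u` controls slabs but no individual slice, so `|f|² ≤ 2|u|² + 2|u - f|²` is
integrated over the slab `δ < t ≤ 2δ` of thickness `δ`. -/
lemma lintegral_trace_le {s : ℝ} (hs : 0 < s) {δ : ℝ} (hδ : 0 < δ) {c : ℝ} (hc : 0 < c)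
    (hcle : ∀ t ∈ Set.Ioc δ (2 * δ), c ≤ t ^ (1 - 2 * s))
    {u : Plane × ℝ → ℝ} (hu : StronglyMeasurable u) {f : Plane → ℝ} {A : ENNReal}
    (hA : ∀ᵐ t ∂volume.restrict (Set.Ioi (0 : ℝ)),
      ∫⁻ x, ‖u (x, t) - f x‖ₑ ^ 2 ≤ ENNReal.ofReal (t ^ (2 * s) / (2 * s)) * A) :
    ENNReal.ofReal δ * ∫⁻ x, ‖f x‖ₑ ^ 2
      ≤ 2 * (ENNReal.ofReal c⁻¹ * ∫⁻ p, ‖u p‖ₑ ^ 2 ∂gradMeasure s)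
        + 2 * (ENNReal.ofReal ((2 * δ) ^ (2 * s) / (2 * s)) * A * ENNReal.ofReal δ) := by
  have hum : Measurable fun p => ‖u p‖ₑ ^ 2 := hu.enorm.pow_const 2
  have hvol : volume (Set.Ioc δ (2 * δ)) = ENNReal.ofReal δ := by
    rw [Real.volume_Ioc]
    congr 1
    ring
  have hsub : Set.Ioc δ (2 * δ) ⊆ Set.Ioi 0 := fun t ht => hδ.trans ht.1
  calc ENNReal.ofReal δ * ∫⁻ x, ‖f x‖ₑ ^ 2
      = ∫⁻ t in Set.Ioc δ (2 * δ), ∫⁻ x, ‖f x‖ₑ ^ 2 := by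
        rw [lintegral_const, Measure.restrict_apply_univ, hvol, mul_comm]
    _ ≤ ∫⁻ t in Set.Ioc δ (2 * δ), (2 * (∫⁻ x, ‖u (x, t)‖ₑ ^ 2)
          + 2 * (ENNReal.ofReal ((2 * δ) ^ (2 * s) / (2 * s)) * A)) := by
        refine lintegral_mono_ae ?_
        filter_upwards [ae_mono (Measure.restrict_mono hsub le_rfl) hA,
          ae_restrict_mem measurableSet_Ioc] with t ht htm
        have hux : Measurable fun x => ‖u (x, t)‖ₑ ^ 2 :=
          hum.comp (by fun_prop : Measurable fun x : Plane => (x, t))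
        calc ∫⁻ x, ‖f x‖ₑ ^ 2
            ≤ ∫⁻ x, (2 * ‖u (x, t)‖ₑ ^ 2 + 2 * ‖u (x, t) - f x‖ₑ ^ 2) := by
              refine lintegral_mono fun x => ?_
              simpa using enorm_sub_sq_le 0 (u (x, t)) (f x)
          _ = 2 * (∫⁻ x, ‖u (x, t)‖ₑ ^ 2) + 2 * ∫⁻ x, ‖u (x, t) - f x‖ₑ ^ 2 := by
              rw [lintegral_add_left (hux.const_mul 2), lintegral_const_mul _ hux,
                lintegral_const_mul' _ _ (by simp)]
          _ ≤ _ := by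
              gcongr
              refine ht.trans ?_
              gcongr
              · exact (hδ.trans htm.1).le
              · exact htm.2
    _ = 2 * (∫⁻ t in Set.Ioc δ (2 * δ), ∫⁻ x, ‖u (x, t)‖ₑ ^ 2)
        + 2 * (ENNReal.ofReal ((2 * δ) ^ (2 * s) / (2 * s)) * A * ENNReal.ofReal δ) := by
        rw [lintegral_add_right _ measurable_const, lintegral_const_mul' _ _ (by simp),
          lintegral_const, Measure.restrict_apply_univ, hvol]
        ring
    _ ≤ _ := by
        gcongr
        exact lintegral_slab_le hδ hc hcle hum

/-- Every interval `(0, ε)` has positive length. Without this, essential limits at `0` would be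
vacuous and traces not unique. -/
instance : (𝓝[>] (0 : ℝ) ⊓ ae (volume : Measure ℝ)).NeBot := by
  rw [inf_neBot_iff]
  intro s hs s' hs'
  obtain ⟨ε, hε, hsub⟩ := mem_nhdsGT_iff_exists_Ioo_subset.1 hs
  by_contra hcon
  have h1 : Set.Ioo 0 ε ⊆ s'ᶜ := fun t ht ht' => hcon ⟨t, hsub ht, ht'⟩
  have h2 : volume (Set.Ioo 0 ε) = 0 := measure_mono_null h1 hs'
  rw [Real.volume_Ioo, sub_zero, ENNReal.ofReal_eq_zero] at h2
  exact absurd hε (not_lt.2 h2)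

lemma eventually_slice {P : ℝ → Prop} (h : ∀ᵐ t ∂volume.restrict (Set.Ioi (0 : ℝ)), P t) :
    ∀ᶠ t in 𝓝[>] (0 : ℝ) ⊓ ae (volume : Measure ℝ), P t := by
  rw [ae_restrict_iff' measurableSet_Ioi] at h
  filter_upwards [mem_inf_of_right h, mem_inf_of_left self_mem_nhdsWithin] with t ht h0
  exact ht h0

lemma ae_slice {P : Plane × ℝ → Prop} (h : ∀ᵐ p ∂halfMeasure, P p) :
    ∀ᵐ t ∂volume.restrict (Set.Ioi (0 : ℝ)), ∀ᵐ x, P (x, t) := by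
  rw [halfMeasure_eq_prod] at h
  exact Measure.ae_ae_of_ae_prod (Measure.measurePreserving_swap.quasiMeasurePreserving.ae h)

lemma lintegral_sq_eq_eLpNorm {α E : Type*} [MeasurableSpace α] [NormedAddCommGroup E]
    (μ : Measure α) (f : α → E) : ∫⁻ a, ‖f a‖ₑ ^ 2 ∂μ = eLpNorm f 2 μ ^ 2 := by
  have h := eLpNorm_nnreal_pow_eq_lintegral (μ := μ) (f := f) (p := 2) two_ne_zero
  simpa [ENNReal.rpow_ofNat] using h.symm

lemma isTrace_of_rate {s : ℝ} (hs : 0 < s) {u : Plane × ℝ → ℝ} {f : Plane → ℝ} {A : ENNReal}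
    (hAfin : A ≠ ⊤) (hA : ∀ᵐ t ∂volume.restrict (Set.Ioi (0 : ℝ)),
      ∫⁻ x, ‖u (x, t) - f x‖ₑ ^ 2 ≤ ENNReal.ofReal (t ^ (2 * s) / (2 * s)) * A) :
    IsTrace u f := by
  have h1 : Tendsto (fun t : ℝ => t ^ (2 * s) / (2 * s)) (𝓝 0) (𝓝 0) := by
    have := (Real.continuousAt_rpow_const 0 (2 * s) (Or.inr (by positivity))).tendsto
    rw [Real.zero_rpow (by positivity)] at this
    simpa using this.div_const (2 * s)
  have h2 : Tendsto (fun t : ℝ => ENNReal.ofReal (t ^ (2 * s) / (2 * s)) * A) (𝓝 0) (𝓝 0) := by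
    simpa using ENNReal.Tendsto.mul_const (ENNReal.tendsto_ofReal h1) (Or.inr hAfin)
  have h3 : Tendsto (fun t : ℝ => (ENNReal.ofReal (t ^ (2 * s) / (2 * s)) * A) ^ (1 / 2 : ℝ))
      (𝓝 0) (𝓝 0) := by
    have := ((ENNReal.continuous_rpow_const (y := (1 / 2 : ℝ))).tendsto 0).comp h2
    rwa [ENNReal.zero_rpow_of_pos (by norm_num)] at this
  refine tendsto_of_tendsto_of_tendsto_of_le_of_le' tendsto_const_nhds
    (h3.mono_left (inf_le_left.trans nhdsWithin_le_nhds)) (Eventually.of_forall fun t => zero_le)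
    ((eventually_slice hA).mono fun t ht => ?_)
  rw [lintegral_sq_eq_eLpNorm] at ht
  rw [one_div, ENNReal.le_rpow_inv_iff two_pos]
  simpa [ENNReal.rpow_ofNat] using ht

lemma IsTrace.congr {u u' : Plane × ℝ → ℝ} {f f' : Plane → ℝ} (h : IsTrace u f)
    (hu : u =ᵐ[halfMeasure] u') (hf : f =ᵐ[volume] f') : IsTrace u' f' := by
  refine Tendsto.congr' ((eventually_slice (ae_slice hu)).mono fun t ht => ?_) h
  refine eLpNorm_congr_ae ?_
  filter_upwards [ht, hf] with x h1 h2
  rw [h1, h2]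

lemma IsTrace.add {u u' : Plane × ℝ → ℝ} {f f' : Plane → ℝ} (h : IsTrace u f)
    (h' : IsTrace u' f') (hu : StronglyMeasurable u) (hu' : StronglyMeasurable u')
    (hf : StronglyMeasurable f) (hf' : StronglyMeasurable f') : IsTrace (u + u') (f + f') := by
  have hs := Tendsto.add h h'
  rw [add_zero] at hs
  refine tendsto_of_tendsto_of_tendsto_of_le_of_le tendsto_const_nhds hs (fun t => zero_le)
    fun t => ?_
  have m : Measurable fun x : Plane => (x, t) := by fun_prop
  refine le_trans (le_of_eq ?_) (eLpNorm_add_le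
    ((hu.comp_measurable m).sub hf).aestronglyMeasurable
    ((hu'.comp_measurable m).sub hf').aestronglyMeasurable one_le_two)
  congr 1
  ext x
  simp only [Pi.add_apply]
  ring

lemma IsTrace.smul {u : Plane × ℝ → ℝ} {f : Plane → ℝ} (h : IsTrace u f) (c : ℝ) :
    IsTrace (c • u) (c • f) := by
  have hs := ENNReal.Tendsto.const_mul (a := ‖c‖ₑ) h (Or.inr enorm_ne_top)
  rw [mul_zero] at hs
  refine hs.congr fun t => ?_
  rw [← eLpNorm_const_smul]
  congr 1
  ext x
  simp [mul_sub]

lemma IsTrace.unique {u : Plane × ℝ → ℝ} {f f' : Plane → ℝ} (h : IsTrace u f)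
    (h' : IsTrace u f') (hu : StronglyMeasurable u) (hf : StronglyMeasurable f)
    (hf' : StronglyMeasurable f') : f =ᵐ[volume] f' := by
  have hs := Tendsto.add h h'
  rw [add_zero] at hs
  have h0 : eLpNorm (f' - f) 2 volume ≤ 0 := by
    -- The triangle inequality through the common slice `u(·, t)` bounds a quantity independent of
    -- `t`.
    refine ge_of_tendsto' hs fun t => ?_
    have m : Measurable fun x : Plane => (x, t) := by fun_prop
    refine le_trans (le_of_eq ?_) (eLpNorm_sub_le
      ((hu.comp_measurable m).sub hf).aestronglyMeasurable
      ((hu.comp_measurable m).sub hf').aestronglyMeasurable one_le_two)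
    congr 1
    ext x
    simp
  have h1 := (eLpNorm_eq_zero_iff (hf'.sub hf).aestronglyMeasurable two_ne_zero).1
    (le_zero_iff.1 h0)
  filter_upwards [h1] with x hx
  exact (sub_eq_zero.1 hx).symm

end SchrodingerExtension

/-! ### The bounded trace operator; horizontal translations and Jensen's inequality -/

namespace SchrodingerExtension

lemma lintegral_sq_coeFn {α E : Type*} [MeasurableSpace α] [NormedAddCommGroup E]
    {μ : Measure α} (f : Lp E 2 μ) : ∫⁻ a, ‖f a‖ₑ ^ 2 ∂μ = ENNReal.ofReal (‖f‖ ^ 2) := by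
  rw [lintegral_sq_eq_eLpNorm, ← Lp.enorm_def, ← ofReal_norm,
    ENNReal.ofReal_pow (norm_nonneg _)]

lemma norm_sq_le_of_lintegral_le {α E : Type*} [MeasurableSpace α] [NormedAddCommGroup E]
    {μ : Measure α} {f : Lp E 2 μ} {b : ℝ} (hb : 0 ≤ b)
    (h : ∫⁻ a, ‖f a‖ₑ ^ 2 ∂μ ≤ ENNReal.ofReal b) : ‖f‖ ^ 2 ≤ b := by
  rwa [lintegral_sq_coeFn, ENNReal.ofReal_le_ofReal_iff hb] at h

lemma two_mul_ofReal (a : ℝ) : 2 * ENNReal.ofReal a = ENNReal.ofReal (2 * a) := by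
  rw [ENNReal.ofReal_mul zero_le_two, ENNReal.ofReal_ofNat]

variable {V : Plane → ℝ} {hVc : Continuous V} {hVpos : ∀ x, 0 < V x} {s : ℝ}

lemma norm_sq_extensionSpace (z : extensionSpace V hVc hVpos s) :
    ‖z‖ ^ 2 = ‖z.1.fst‖ ^ 2 + ‖z.1.snd‖ ^ 2 := by
  rw [Submodule.coe_norm, WithLp.prod_norm_sq_eq_of_L2]

/-- The slices of `u` converge to `f` in `L²` at the rate `t ^ s` dictated by the size `A` of the
weighted gradient. -/
def HasTraceRate (s : ℝ) (u : Plane × ℝ → ℝ) (f : Plane → ℝ) (A : ENNReal) : Prop :=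
  ∀ᵐ t ∂volume.restrict (Set.Ioi (0 : ℝ)),
    ∫⁻ x, ‖u (x, t) - f x‖ₑ ^ 2 ≤ ENNReal.ofReal (t ^ (2 * s) / (2 * s)) * A

lemma exists_trace_bound (hs : 0 < s) {V₀ : ℝ} (hV₀ : 0 < V₀) (hV : ∀ x, V₀ ≤ V x) :
    ∃ C : ℝ, 0 ≤ C ∧ ∀ z : extensionSpace V hVc hVpos s, ∃ f : Lp ℝ 2 (volume : Measure Plane),
      HasTraceRate s z.1.fst f (ENNReal.ofReal (‖z.1.snd‖ ^ 2)) ∧ ‖f‖ ^ 2 ≤ C * ‖z‖ ^ 2 := by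
  -- For boundedness the slab with `δ = 1` suffices. In the constant below, the first summand is the
  -- coefficient of the potential part of the norm and the second that of the gradient part.
  obtain ⟨c, hc, hcle⟩ := exists_le_rpow one_pos (1 - 2 * s)
  refine ⟨2 * (c⁻¹ * V₀⁻¹) + 2 * ((2 : ℝ) ^ (2 * s) / (2 * s)), by positivity, fun z => ?_⟩
  have hu := Lp.stronglyMeasurable z.1.fst
  have hA := lintegral_sq_coeFn z.1.snd
  obtain ⟨f, hf, hrate⟩ := z.2.2.exists_trace hs hu (Lp.stronglyMeasurable z.1.snd)
    (by rw [hA]; exact ENNReal.ofReal_ne_top)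
  rw [hA] at hrate
  have hbound : ∫⁻ x, ‖f x‖ₑ ^ 2 ≤ ENNReal.ofReal
      ((2 * (c⁻¹ * V₀⁻¹) + 2 * ((2 : ℝ) ^ (2 * s) / (2 * s))) * ‖z‖ ^ 2) := by
    have h1 := lintegral_trace_le hs one_pos hc hcle hu hrate
    have h2 := lintegral_gradMeasure_le hVc hV₀ hV (s := s) (hu.enorm.pow_const 2)
    rw [lintegral_sq_coeFn] at h2
    simp only [ENNReal.ofReal_one, one_mul, mul_one] at h1
    refine (h1.trans (add_le_add_left (mul_le_mul_right (mul_le_mul_right h2 _) _) _)).trans ?_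
    rw [← ENNReal.ofReal_mul (by positivity), ← ENNReal.ofReal_mul (by positivity),
      ← ENNReal.ofReal_mul (by positivity), two_mul_ofReal, two_mul_ofReal,
      ← ENNReal.ofReal_add (by positivity) (by positivity)]
    refine ENNReal.ofReal_le_ofReal ?_
    rw [norm_sq_extensionSpace]
    have i1 : 0 ≤ 2 * (c⁻¹ * V₀⁻¹) * ‖z.1.snd‖ ^ 2 := by positivity
    have i2 : 0 ≤ 2 * ((2 : ℝ) ^ (2 * s) / (2 * s)) * ‖z.1.fst‖ ^ 2 := by positivity
    nlinarith
  have hmem : MemLp f 2 volume := by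
    refine ⟨hf.aestronglyMeasurable, ?_⟩
    rw [lintegral_sq_eq_eLpNorm] at hbound
    have := hbound.trans_lt ENNReal.ofReal_lt_top
    exact (ENNReal.pow_lt_top_iff.1 this).resolve_right two_ne_zero
  refine ⟨hmem.toLp f, ?_, norm_sq_le_of_lintegral_le (by positivity) ?_⟩
  · filter_upwards [hrate] with t ht
    refine le_of_eq_of_le (lintegral_congr_ae ?_) ht
    filter_upwards [hmem.coeFn_toLp] with x hx
    rw [hx]
  · refine le_of_eq_of_le (lintegral_congr_ae ?_) hbound
    filter_upwards [hmem.coeFn_toLp] with x hx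
    rw [hx]

/-- The trace operator. -/
lemma exists_trace_operator (hs : 0 < s) {V₀ : ℝ} (hV₀ : 0 < V₀) (hV : ∀ x, V₀ ≤ V x) :
    ∃ T : extensionSpace V hVc hVpos s →L[ℝ] Lp ℝ 2 (volume : Measure Plane),
      ∀ z, HasTraceRate s z.1.fst (T z) (ENNReal.ofReal (‖z.1.snd‖ ^ 2)) := by
  obtain ⟨C, hC, h⟩ := exists_trace_bound (hVc := hVc) (hVpos := hVpos) hs hV₀ hV
  -- The chosen traces carry no linear structure; additivity and homogeneity follow from uniqueness
  -- of the trace.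
  choose T hT hTC using h
  have htr : ∀ z, IsTrace z.1.fst (T z) := fun z => isTrace_of_rate hs ENNReal.ofReal_ne_top (hT z)
  have huniq : ∀ z (f : Lp ℝ 2 (volume : Measure Plane)), IsTrace z.1.fst f → T z = f :=
    fun z f hf => Lp.ext ((htr z).unique hf (Lp.stronglyMeasurable _) (Lp.stronglyMeasurable _)
      (Lp.stronglyMeasurable _))
  let L : extensionSpace V hVc hVpos s →ₗ[ℝ] Lp ℝ 2 (volume : Measure Plane) :=
    { toFun := T
      map_add' := fun z z' => by
        refine huniq _ _ (((htr z).add (htr z') (Lp.stronglyMeasurable _)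
          (Lp.stronglyMeasurable _) (Lp.stronglyMeasurable _) (Lp.stronglyMeasurable _)).congr
          ?_ (Lp.coeFn_add _ _).symm)
        exact (halfMeasure_ac_potMeasure hVc hVpos s).ae_eq
          (Lp.coeFn_add z.1.fst z'.1.fst).symm
      map_smul' := fun c z => by
        refine huniq _ _ (((htr z).smul c).congr ?_ (Lp.coeFn_smul _ _).symm)
        exact (halfMeasure_ac_potMeasure hVc hVpos s).ae_eq (Lp.coeFn_smul c z.1.fst).symm }
  refine ⟨L.mkContinuous √C fun z => ?_, hT⟩
  refine abs_le_of_sq_le_sq' ?_ (by positivity) |>.2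
  rw [mul_pow, Real.sq_sqrt hC]
  exact hTC z

/-- Horizontal translation of a weakly differentiable function. -/
lemma HasWeakGradient.lintegral_translate_le {u : Plane × ℝ → ℝ} {g : Plane × ℝ → Grad}
    (h : HasWeakGradient u g) (hg : StronglyMeasurable g) {δ : ℝ} (hδ : 0 < δ) (y : Plane) :
    ∫⁻ t in Set.Ioc δ (2 * δ), ∫⁻ x, ‖u (x, t) - u (y + x, t)‖ₑ ^ 2
      ≤ ENNReal.ofReal (‖y‖ ^ 2) * ∫⁻ t in Set.Ioc δ (2 * δ), ∫⁻ x, ‖g (x, t)‖ₑ ^ 2 := by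
  have hgm : Measurable fun p => ‖g p‖ₑ := hg.enorm
  -- The direction is horizontal, so the segments stay at one height and the identity can be read
  -- slice by slice.
  have hdiff := ae_slice (h.ae_sub_eq_integral (v := (y, 0)) le_rfl)
  rw [← lintegral_const_mul' _ _ ENNReal.ofReal_ne_top]
  refine lintegral_mono_ae ?_
  filter_upwards [ae_mono (Measure.restrict_mono
    (fun t ht => hδ.trans ht.1 : Set.Ioc δ (2 * δ) ⊆ Set.Ioi 0) le_rfl) hdiff] with t ht
  have hnorm : ‖(WithLp.toLp 2 (y, 0) : Grad)‖ = ‖y‖ := by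
    simp
  calc ∫⁻ x, ‖u (x, t) - u (y + x, t)‖ₑ ^ 2
      ≤ ∫⁻ x, ENNReal.ofReal (‖y‖ ^ 2) * ∫⁻ τ in Set.Ioc (0 : ℝ) 1, ‖g (x + τ • y, t)‖ₑ ^ 2 := by
        refine lintegral_mono_ae ?_
        filter_upwards [ht] with x hx
        have hmx : Measurable fun τ : ℝ => ‖g (x + τ • y, t)‖ₑ := hgm.comp (by fun_prop)
        have h1 : ‖u (x, t) - u (y + x, t)‖ₑ
            ≤ ‖y‖ₑ * ∫⁻ τ in Set.Ioc (0 : ℝ) 1, ‖g (x + τ • y, t)‖ₑ := by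
          have e1 : u (x, t) - u (y + x, t) = -(u ((x, t) + (y, 0)) - u (x, t)) := by
            simp [add_comm]
          rw [e1, enorm_neg, hx, intervalIntegral.integral_of_le zero_le_one,
            ← lintegral_const_mul _ hmx]
          refine (enorm_integral_le_lintegral_enorm _).trans (lintegral_mono fun τ => ?_)
          rw [← enorm_norm (g _), ← enorm_norm y, ← enorm_mul, enorm_le_iff_norm_le]
          have h2 := norm_inner_le_norm (𝕜 := ℝ) (g ((x, t) + τ • ((y, 0) : Plane × ℝ)))
            (WithLp.toLp 2 (y, 0))
          rw [hnorm] at h2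
          simpa [mul_comm] using h2
        -- Cauchy–Schwarz against the constant `1` on an interval of length one costs no constant.
        have h3 := sq_lintegral_mul_le (μ := volume.restrict (Set.Ioc (0 : ℝ) 1))
          (f := fun _ => 1) aemeasurable_const hmx.aemeasurable
        simp only [one_mul, one_pow, lintegral_const, Measure.restrict_apply_univ,
          Real.volume_Ioc, sub_zero, ENNReal.ofReal_one] at h3
        refine (pow_le_pow_left₀ (zero_le (a := _)) h1 2).trans ?_
        rw [mul_pow, ENNReal.ofReal_pow (norm_nonneg _), ofReal_norm]
        gcongr
    _ = ENNReal.ofReal (‖y‖ ^ 2) * ∫⁻ τ in Set.Ioc (0 : ℝ) 1, ∫⁻ x, ‖g (x + τ • y, t)‖ₑ ^ 2 := by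
        rw [lintegral_const_mul' _ _ ENNReal.ofReal_ne_top, lintegral_lintegral_swap]
        exact ((hgm.comp (by fun_prop : Measurable fun q : Plane × ℝ =>
          ((q.1 + q.2 • y, t) : Plane × ℝ))).pow_const 2).aemeasurable
    _ = _ := by
        congr 1
        have e : ∀ τ : ℝ, ∫⁻ x, ‖g (x + τ • y, t)‖ₑ ^ 2 = ∫⁻ x, ‖g (x, t)‖ₑ ^ 2 := fun τ =>
          lintegral_add_right_eq_self (fun x => ‖g (x, t)‖ₑ ^ 2) (τ • y)
        simp [e]

/-- Jensen's inequality for the square of the distance to a weighted mean. -/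
lemma enorm_sub_integral_sq_le {α : Type*} [MeasurableSpace α] {μ : Measure α} {w h : α → ℝ}
    (hw0 : ∀ a, 0 ≤ w a) (hwi : Integrable w μ) (hw1 : ∫ a, w a ∂μ = 1) (hwm : Measurable w)
    (hm : Measurable h) (hwh : Integrable (fun a => w a * h a) μ) (c : ℝ) :
    ‖c - ∫ a, w a * h a ∂μ‖ₑ ^ 2 ≤ ∫⁻ a, ENNReal.ofReal (w a) * ‖c - h a‖ₑ ^ 2 ∂μ := by
  have e1 : c - ∫ a, w a * h a ∂μ = ∫ a, w a * (c - h a) ∂μ := by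
    simp only [mul_sub]
    rw [integral_sub (hwi.mul_const c) hwh, integral_mul_const, hw1, one_mul]
  have e2 : ∫⁻ a, ENNReal.ofReal (w a) ∂μ = 1 := by
    rw [← ofReal_integral_eq_lintegral_ofReal hwi (ae_of_all _ hw0), hw1, ENNReal.ofReal_one]
  have hwm' : Measurable fun a => ENNReal.ofReal (w a) := by fun_prop
  have hcm : Measurable fun a => ‖c - h a‖ₑ := by fun_prop
  have h1 : ‖∫ a, w a * (c - h a) ∂μ‖ₑ
      ≤ ∫⁻ a, ‖c - h a‖ₑ ∂μ.withDensity fun a => ENNReal.ofReal (w a) := by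
    rw [lintegral_withDensity_eq_lintegral_mul _ hwm' hcm]
    refine (enorm_integral_le_lintegral_enorm _).trans (lintegral_mono fun a => ?_)
    rw [enorm_mul, Real.enorm_of_nonneg (hw0 a)]
    rfl
  -- The measure with density `w` has total mass one, so Cauchy–Schwarz against `1` is Jensen's
  -- inequality for the square.
  have h2 := sq_lintegral_mul_le (μ := μ.withDensity fun a => ENNReal.ofReal (w a))
    (f := fun _ => 1) aemeasurable_const hcm.aemeasurable
  simp only [one_mul, one_pow, lintegral_one, withDensity_apply _ MeasurableSet.univ,
    Measure.restrict_univ, e2] at h2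
  rw [e1]
  refine (pow_le_pow_left₀ (zero_le (a := _)) h1 2).trans (h2.trans ?_)
  rw [lintegral_withDensity_eq_lintegral_mul _ hwm' (hcm.pow_const 2)]
  rfl

end SchrodingerExtension

/-! ### Local averages over a slab as Hilbert–Schmidt operators -/

namespace SchrodingerExtension

instance (V : Plane → ℝ) (s : ℝ) : SFinite (potMeasure V s) := by
  unfold potMeasure
  infer_instance

/-- A convolution kernel cut off by a square integrable factor is a Hilbert–Schmidt kernel. -/
lemma exists_kernel {μ : Measure (Plane × ℝ)} [SFinite μ] {w : Plane → ℝ} (hw : Continuous w)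
    (hc : HasCompactSupport w) {m : Plane × ℝ → ℝ} (hmm : Measurable m) (hm : MemLp m 2 μ) :
    ∃ k : Lp (Lp ℝ 2 μ) 2 (volume : Measure Plane),
      ∀ᵐ x, k x =ᵐ[μ] fun q => w (q.1 - x) * m q := by
  obtain ⟨B, hB⟩ := hc.exists_bound_of_continuous hw
  have hmeas : ∀ x, Measurable fun q : Plane × ℝ => w (q.1 - x) * m q := fun x =>
    (hw.measurable.comp (by fun_prop)).mul hmm
  have hmem : ∀ x, MemLp (fun q : Plane × ℝ => w (q.1 - x) * m q) 2 μ := fun x =>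
    hm.of_le_mul (c := B) (hmeas x).aestronglyMeasurable (ae_of_all _ fun q => by
      rw [norm_mul]
      gcongr
      exact hB _)
  set K : Plane → Lp ℝ 2 μ := fun x => (hmem x).toLp _ with hK
  have huc : UniformContinuous w := hc.uniformContinuous_of_continuous hw
  -- Uniform continuity of `w` makes the kernel a norm-continuous family, which supplies its strong
  -- measurability.
  have hKc : Continuous K := by
    rw [Metric.continuous_iff]
    intro x ε hε
    have hpos : 0 < ε / (‖hm.toLp m‖ + 1) := by positivity
    obtain ⟨d, hd, hwd⟩ := Metric.uniformContinuous_iff.1 huc _ hpos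
    refine ⟨d, hd, fun y hy => ?_⟩
    rw [dist_eq_norm]
    have h1 : ‖K y - K x‖ ≤ ε / (‖hm.toLp m‖ + 1) * ‖hm.toLp m‖ := by
      refine Lp.norm_le_mul_norm_of_ae_le_mul ?_
      filter_upwards [Lp.coeFn_sub (K y) (K x), (hmem y).coeFn_toLp, (hmem x).coeFn_toLp,
        hm.coeFn_toLp] with q h1 h2 h3 h4
      rw [h1, Pi.sub_apply, h2, h3, h4, ← sub_mul, norm_mul]
      gcongr
      have : dist (q.1 - y) (q.1 - x) < d := by
        rwa [dist_sub_left]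
      exact (dist_eq_norm (w (q.1 - y)) _ ▸ hwd this).le
    refine h1.trans_lt ?_
    rw [div_mul_eq_mul_div, div_lt_iff₀ (by positivity)]
    nlinarith
  have hw2 : MemLp w 2 volume := hw.memLp_of_hasCompactSupport hc
  have hKmem : MemLp K 2 volume := by
    refine ⟨hKc.aestronglyMeasurable, ?_⟩
    -- By Tonelli and translation invariance the Hilbert–Schmidt norm factors as `‖m‖ ‖w‖`.
    have h1 : ∫⁻ x, ‖K x‖ₑ ^ 2 = (∫⁻ q, ‖m q‖ₑ ^ 2 ∂μ) * ∫⁻ x, ‖w x‖ₑ ^ 2 := by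
      have e1 : ∀ x, ‖K x‖ₑ ^ 2 = ∫⁻ q, ‖w (q.1 - x)‖ₑ ^ 2 * ‖m q‖ₑ ^ 2 ∂μ := by
        intro x
        rw [Lp.enorm_def, eLpNorm_congr_ae (hmem x).coeFn_toLp, ← lintegral_sq_eq_eLpNorm]
        simp [enorm_mul, mul_pow]
      have hwm := hw.measurable
      simp_rw [e1]
      rw [lintegral_lintegral_swap (by fun_prop), ← lintegral_mul_const _ (by fun_prop)]
      congr 1 with q
      rw [lintegral_mul_const _ (by fun_prop), mul_comm,
        lintegral_sub_left_eq_self (fun x => ‖w x‖ₑ ^ 2)]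
    rw [lintegral_sq_eq_eLpNorm, lintegral_sq_eq_eLpNorm, lintegral_sq_eq_eLpNorm] at h1
    have h2 : eLpNorm K 2 volume ^ 2 < ⊤ := by
      rw [h1]
      exact ENNReal.mul_lt_top (ENNReal.pow_lt_top hm.2) (ENNReal.pow_lt_top hw2.2)
    exact (ENNReal.pow_lt_top_iff.1 h2).resolve_right two_ne_zero
  refine ⟨hKmem.toLp K, ?_⟩
  filter_upwards [hKmem.coeFn_toLp] with x hx
  rw [hx]
  exact (hmem x).coeFn_toLp

/-- The density of the uniform distribution on `(δ, 2δ]`. -/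
noncomputable def slabDensity (δ : ℝ) : ℝ → ℝ := (Set.Ioc δ (2 * δ)).indicator fun _ => δ⁻¹

lemma measurable_slabDensity (δ : ℝ) : Measurable (slabDensity δ) :=
  measurable_const.indicator measurableSet_Ioc

lemma slabDensity_nonneg {δ : ℝ} (hδ : 0 < δ) (t : ℝ) : 0 ≤ slabDensity δ t :=
  Set.indicator_nonneg (fun _ _ => (inv_pos.2 hδ).le) t

lemma integrable_slabDensity (δ : ℝ) :
    Integrable (slabDensity δ) (volume.restrict (Set.Ioi 0)) :=
  ((integrable_indicator_iff measurableSet_Ioc).2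
    (integrableOn_const (by simp))).mono_measure Measure.restrict_le_self

lemma integral_slabDensity {δ : ℝ} (hδ : 0 < δ) :
    ∫ t in Set.Ioi 0, slabDensity δ t = 1 := by
  have hsub : Set.Ioc δ (2 * δ) ⊆ Set.Ioi 0 := fun t ht => hδ.trans ht.1
  rw [slabDensity, setIntegral_indicator measurableSet_Ioc, Set.inter_eq_right.2 hsub,
    setIntegral_const]
  have : volume.real (Set.Ioc δ (2 * δ)) = δ := by
    rw [Real.volume_real_Ioc_of_le (by linarith)]
    ring
  rw [this, smul_eq_mul, mul_inv_cancel₀ hδ.ne']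

variable {V : Plane → ℝ} {s : ℝ}

lemma measurable_density (hVc : Continuous V) :
    Measurable fun p : Plane × ℝ => ENNReal.ofReal (V p.1 * p.2 ^ (1 - 2 * s)) := by
  have hVm := hVc.measurable
  fun_prop

lemma integrable_potMeasure_iff (hVc : Continuous V) (hVpos : ∀ x, 0 < V x)
    {f : Plane × ℝ → ℝ} : Integrable f (potMeasure V s)
      ↔ Integrable (fun p => V p.1 * p.2 ^ (1 - 2 * s) * f p) halfMeasure := by
  rw [potMeasure, integrable_withDensity_iff_integrable_smul' (measurable_density hVc)
    (ae_of_all _ fun _ => ENNReal.ofReal_lt_top)]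
  refine integrable_congr ?_
  filter_upwards [ae_restrict_mem measurableSet_halfSpace] with p hp
  rw [ENNReal.toReal_ofReal (mul_nonneg (hVpos _).le (Real.rpow_nonneg (le_of_lt hp) _)),
    smul_eq_mul]

lemma integral_potMeasure (hVc : Continuous V) (hVpos : ∀ x, 0 < V x) (f : Plane × ℝ → ℝ) :
    ∫ p, f p ∂potMeasure V s = ∫ p, V p.1 * p.2 ^ (1 - 2 * s) * f p ∂halfMeasure := by
  rw [potMeasure, integral_withDensity_eq_integral_toReal_smul (measurable_density hVc)
    (ae_of_all _ fun _ => ENNReal.ofReal_lt_top)]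
  refine integral_congr_ae ?_
  filter_upwards [ae_restrict_mem measurableSet_halfSpace] with p hp
  rw [ENNReal.toReal_ofReal (mul_nonneg (hVpos _).le (Real.rpow_nonneg (le_of_lt hp) _)),
    smul_eq_mul]

/-- The uniform density on a slab, relative to `V t^(1-2s) dx dt`. -/
noncomputable def slabKernel (V : Plane → ℝ) (s δ : ℝ) (q : Plane × ℝ) : ℝ :=
  slabDensity δ q.2 * (V q.1 * q.2 ^ (1 - 2 * s))⁻¹

lemma measurable_slabKernel (hVc : Continuous V) (δ : ℝ) : Measurable (slabKernel V s δ) := by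
  have hVm := hVc.measurable
  exact ((measurable_slabDensity δ).comp measurable_snd).mul (by fun_prop)

lemma density_mul_slabKernel (hVpos : ∀ x, 0 < V x) (δ : ℝ) {p : Plane × ℝ}
    (hp : p ∈ halfSpace) : V p.1 * p.2 ^ (1 - 2 * s) * slabKernel V s δ p = slabDensity δ p.2 := by
  have : V p.1 * p.2 ^ (1 - 2 * s) ≠ 0 :=
    (mul_pos (hVpos _) (Real.rpow_pos_of_pos hp _)).ne'
  rw [slabKernel, mul_left_comm, mul_inv_cancel₀ this, mul_one]

/-- Squaring the kernel and multiplying by the density leaves `1/V(x)` times `δ⁻² t^(-(1-2s))` on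
the slab. The first factor is integrable by hypothesis, the second because the slab stays away from
`t = 0`. -/
lemma memLp_slabKernel (hVc : Continuous V) (hVpos : ∀ x, 0 < V x)
    (hVint : Integrable (fun x => 1 / V x) volume) {δ : ℝ} (hδ : 0 < δ) :
    MemLp (slabKernel V s δ) 2 (potMeasure V s) := by
  rw [memLp_two_iff_integrable_sq (measurable_slabKernel hVc δ).aestronglyMeasurable,
    integrable_potMeasure_iff hVc hVpos, halfMeasure_eq_prod]
  have h1 : Integrable ((Set.Ioc δ (2 * δ)).indicator fun t : ℝ => δ⁻¹ ^ 2 * (t ^ (1 - 2 * s))⁻¹)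
      (volume.restrict (Set.Ioi 0)) := by
    refine ((integrable_indicator_iff measurableSet_Ioc).2 ?_).mono_measure
      Measure.restrict_le_self
    refine IntegrableOn.mono_set (ContinuousOn.integrableOn_compact isCompact_Icc ?_)
      Set.Ioc_subset_Icc_self
    refine continuousOn_const.mul (ContinuousOn.inv₀ (fun t ht => ?_) fun t ht => ?_)
    · exact (Real.continuousAt_rpow_const _ _
        (Or.inl (hδ.trans_le ht.1).ne')).continuousWithinAt
    · exact (Real.rpow_pos_of_pos (hδ.trans_le ht.1) _).ne'
  refine (hVint.mul_prod h1).congr ?_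
  rw [← halfMeasure_eq_prod]
  filter_upwards [ae_restrict_mem measurableSet_halfSpace] with p hp
  have hV1 := (hVpos p.1).ne'
  have ht := (Real.rpow_pos_of_pos hp (1 - 2 * s)).ne'
  rw [slabKernel, slabDensity]
  by_cases hmem : p.2 ∈ Set.Ioc δ (2 * δ)
  · simp only [Set.indicator_of_mem hmem]
    field_simp
  · simp [Set.indicator_of_notMem hmem]

/-- The local averages of `u` over a slab, as a Hilbert–Schmidt operator. -/
lemma exists_average_operator (hVc : Continuous V) (hVpos : ∀ x, 0 < V x)
    (hVint : Integrable (fun x => 1 / V x) volume) {δ : ℝ} (hδ : 0 < δ) {w : Plane → ℝ}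
    (hw : Continuous w) (hc : HasCompactSupport w) :
    ∃ S : Lp ℝ 2 (potMeasure V s) →L[ℝ] Lp ℝ 2 (volume : Measure Plane),
      IsCompactOperator S ∧ ∀ u, ∀ᵐ x,
        Integrable (fun q : Plane × ℝ => w (q.1 - x) * slabDensity δ q.2 * u q) halfMeasure ∧
        S u x = ∫ q, w (q.1 - x) * slabDensity δ q.2 * u q ∂halfMeasure := by
  obtain ⟨k, hk⟩ := exists_kernel hw hc (measurable_slabKernel (s := s) hVc δ)
    (memLp_slabKernel hVc hVpos hVint hδ)
  refine ⟨hilbertSchmidt volume k, isCompactOperator_hilbertSchmidt k, fun u => ?_⟩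
  filter_upwards [hk, coeFn_hilbertSchmidt k u] with x hkx hx
  -- The weight in the inner product cancels the reciprocal weight in the kernel, leaving an average
  -- with respect to `dx dt`.
  have e : (fun q : Plane × ℝ => V q.1 * q.2 ^ (1 - 2 * s) * inner ℝ (u q) (k x q))
      =ᵐ[halfMeasure] fun q => w (q.1 - x) * slabDensity δ q.2 * u q := by
    filter_upwards [(halfMeasure_ac_potMeasure hVc hVpos s).ae_le hkx,
      ae_restrict_mem measurableSet_halfSpace] with q hq hqs
    rw [hq, ← density_mul_slabKernel (s := s) hVpos δ hqs]
    simp only [RCLike.inner_apply, conj_trivial]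
    ring
  constructor
  · exact ((integrable_potMeasure_iff hVc hVpos).1 (L2.integrable_inner u (k x))).congr e
  · rw [hx, L2.inner_def, integral_potMeasure hVc hVpos, integral_congr_ae e]

end SchrodingerExtension

/-! ### Norm approximation of the trace by averages -/

namespace SchrodingerExtension

variable {V : Plane → ℝ} {hVc : Continuous V} {hVpos : ∀ x, 0 < V x} {s : ℝ}

/-- Passing through `u(x, t)` splits the displacement into a vertical part, bounded by the trace
rate, and a horizontal part, bounded by `‖y‖` and the gradient on the slab, where the weight is at
least `c`. -/
lemma lintegral_slab_sub_le {δ : ℝ} (hs : 0 < s) (hδ : 0 < δ) {c : ℝ} (hc : 0 < c)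
    (hcle : ∀ t ∈ Set.Ioc δ (2 * δ), c ≤ t ^ (1 - 2 * s))
    {u : Plane × ℝ → ℝ} {g : Plane × ℝ → Grad} (h : HasWeakGradient u g)
    (hu : StronglyMeasurable u) (hg : StronglyMeasurable g) {f : Plane → ℝ}
    (hf : StronglyMeasurable f) {A : ℝ} (hA0 : 0 ≤ A)
    (hA : ∫⁻ p, ‖g p‖ₑ ^ 2 ∂gradMeasure s = ENNReal.ofReal A)
    (hrate : HasTraceRate s u f (ENNReal.ofReal A)) (y : Plane) :
    ∫⁻ t in Set.Ioc δ (2 * δ), ∫⁻ x, ‖f x - u (y + x, t)‖ₑ ^ 2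
      ≤ ENNReal.ofReal ((2 * ((2 * δ) ^ (2 * s) / (2 * s) * δ) + 2 * (‖y‖ ^ 2 * c⁻¹)) * A) := by
  have hum := hu.measurable
  have hfm := hf.measurable
  have hsub : Set.Ioc δ (2 * δ) ⊆ Set.Ioi 0 := fun t ht => hδ.trans ht.1
  have hvol : volume (Set.Ioc δ (2 * δ)) = ENNReal.ofReal δ := by
    rw [Real.volume_Ioc]
    congr 1
    ring
  have h1 : ∫⁻ t in Set.Ioc δ (2 * δ), ∫⁻ x, ‖f x - u (x, t)‖ₑ ^ 2
      ≤ ENNReal.ofReal ((2 * δ) ^ (2 * s) / (2 * s) * δ * A) := by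
    calc _ ≤ ∫⁻ t in Set.Ioc δ (2 * δ),
          ENNReal.ofReal ((2 * δ) ^ (2 * s) / (2 * s)) * ENNReal.ofReal A := by
          refine lintegral_mono_ae ?_
          filter_upwards [ae_mono (Measure.restrict_mono hsub le_rfl) hrate,
            ae_restrict_mem measurableSet_Ioc] with t ht htm
          simp_rw [← enorm_neg (f _ - u _), neg_sub]
          refine ht.trans ?_
          gcongr
          · exact (hδ.trans htm.1).le
          · exact htm.2
      _ = _ := by
          rw [lintegral_const, Measure.restrict_apply_univ, hvol,
            ← ENNReal.ofReal_mul (by positivity), ← ENNReal.ofReal_mul (by positivity)]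
          congr 1
          ring
  have h2 : ∫⁻ t in Set.Ioc δ (2 * δ), ∫⁻ x, ‖u (x, t) - u (y + x, t)‖ₑ ^ 2
      ≤ ENNReal.ofReal (‖y‖ ^ 2 * c⁻¹ * A) := by
    refine (h.lintegral_translate_le hg hδ y).trans ?_
    rw [mul_assoc, ENNReal.ofReal_mul (by positivity), ENNReal.ofReal_mul (by positivity), ← hA]
    gcongr
    exact lintegral_slab_le hδ hc hcle (hg.enorm.pow_const 2)
  have hm1 : Measurable fun q : ℝ × Plane => ‖f q.2 - u (q.2, q.1)‖ₑ ^ 2 := by fun_prop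
  calc _ ≤ ∫⁻ t in Set.Ioc δ (2 * δ), ∫⁻ x, (2 * ‖f x - u (x, t)‖ₑ ^ 2
        + 2 * ‖u (x, t) - u (y + x, t)‖ₑ ^ 2) :=
        lintegral_mono fun t => lintegral_mono fun x => enorm_sub_sq_le _ _ _
    _ = ∫⁻ t in Set.Ioc δ (2 * δ), (2 * (∫⁻ x, ‖f x - u (x, t)‖ₑ ^ 2)
        + 2 * ∫⁻ x, ‖u (x, t) - u (y + x, t)‖ₑ ^ 2) := by
        congr 1 with t
        rw [lintegral_add_left (by fun_prop), lintegral_const_mul' _ _ (by simp),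
          lintegral_const_mul' _ _ (by simp)]
    _ = 2 * (∫⁻ t in Set.Ioc δ (2 * δ), ∫⁻ x, ‖f x - u (x, t)‖ₑ ^ 2)
        + 2 * ∫⁻ t in Set.Ioc δ (2 * δ), ∫⁻ x, ‖u (x, t) - u (y + x, t)‖ₑ ^ 2 := by
        rw [lintegral_add_left (hm1.lintegral_prod_right'.const_mul 2),
          lintegral_const_mul' _ _ (by simp), lintegral_const_mul' _ _ (by simp)]
    _ ≤ 2 * ENNReal.ofReal ((2 * δ) ^ (2 * s) / (2 * s) * δ * A)
        + 2 * ENNReal.ofReal (‖y‖ ^ 2 * c⁻¹ * A) := by gcongr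
    _ = _ := by
        rw [two_mul_ofReal, two_mul_ofReal, ← ENNReal.ofReal_add (by positivity) (by positivity)]
        congr 1
        ring

/-- The distance between a function and its local averages over a slab, weighted by a
probability density `w` supported in a ball of radius `η`. -/
lemma lintegral_sub_average_le {δ : ℝ} (hs : 0 < s) (hδ : 0 < δ) {c : ℝ} (hc : 0 < c)
    (hcle : ∀ t ∈ Set.Ioc δ (2 * δ), c ≤ t ^ (1 - 2 * s))
    {u : Plane × ℝ → ℝ} {g : Plane × ℝ → Grad} (h : HasWeakGradient u g)
    (hu : StronglyMeasurable u) (hg : StronglyMeasurable g) {f : Plane → ℝ}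
    (hf : StronglyMeasurable f) {A : ℝ} (hA0 : 0 ≤ A)
    (hA : ∫⁻ p, ‖g p‖ₑ ^ 2 ∂gradMeasure s = ENNReal.ofReal A)
    (hrate : HasTraceRate s u f (ENNReal.ofReal A)) {w : Plane → ℝ} (hw : Continuous w)
    (hw0 : ∀ x, 0 ≤ w x) (hwi : Integrable w volume) (hw1 : ∫ x, w x = 1) {η : ℝ}
    (hwη : ∀ x, w x ≠ 0 → ‖x‖ ≤ η)
    (hint : ∀ᵐ x, Integrable (fun q : Plane × ℝ => w (q.1 - x) * slabDensity δ q.2 * u q)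
      halfMeasure) :
    ∫⁻ x, ‖f x - ∫ q, w (q.1 - x) * slabDensity δ q.2 * u q ∂halfMeasure‖ₑ ^ 2
      ≤ ENNReal.ofReal
        (δ⁻¹ * ((2 * ((2 * δ) ^ (2 * s) / (2 * s) * δ) + 2 * (η ^ 2 * c⁻¹)) * A)) := by
  have hum := hu.measurable
  have hfm := hf.measurable
  have hwm := hw.measurable
  have ham := measurable_slabDensity δ
  have hsub : Set.Ioc δ (2 * δ) ⊆ Set.Ioi 0 := fun t ht => hδ.trans ht.1
  set B := (2 * ((2 * δ) ^ (2 * s) / (2 * s) * δ) + 2 * (η ^ 2 * c⁻¹)) * A with hB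
  have hmF : Measurable fun r : (Plane × Plane) × ℝ => ‖f r.1.1 - u (r.1.2 + r.1.1, r.2)‖ₑ ^ 2 := by
    fun_prop
  have hinner : ∀ x, ∫⁻ q, ENNReal.ofReal (w (q.1 - x) * slabDensity δ q.2) * ‖f x - u q‖ₑ ^ 2
        ∂halfMeasure
      = ∫⁻ y, ENNReal.ofReal (w y) * (ENNReal.ofReal δ⁻¹
        * ∫⁻ t in Set.Ioc δ (2 * δ), ‖f x - u (y + x, t)‖ₑ ^ 2) := by
    intro x
    -- Recentring at `x` makes the weight `w y` independent of `x`, so that the `x`-integral can be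
    -- taken first for each fixed displacement `y`.
    rw [halfMeasure_eq_prod, lintegral_prod _ (by fun_prop), ← lintegral_add_right_eq_self _ x]
    congr 1 with y
    rw [← lintegral_const_mul' _ _ ENNReal.ofReal_ne_top,
      ← lintegral_const_mul' _ _ ENNReal.ofReal_ne_top, ← Set.inter_eq_left.2 hsub,
      ← setLIntegral_indicator measurableSet_Ioc]
    congr 1 with t
    rw [add_sub_cancel_right, ENNReal.ofReal_mul (hw0 _), mul_assoc]
    by_cases ht : t ∈ Set.Ioc δ (2 * δ)
    · simp [slabDensity, ht]
    · simp [slabDensity, ht]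
  calc _ ≤ ∫⁻ x, ∫⁻ q, ENNReal.ofReal (w (q.1 - x) * slabDensity δ q.2) * ‖f x - u q‖ₑ ^ 2
        ∂halfMeasure := by
        refine lintegral_mono_ae ?_
        filter_upwards [hint] with x hx
        have hwx : Integrable (fun y => w (y - x)) volume := hwi.comp_sub_right x
        refine enorm_sub_integral_sq_le
          (fun q => mul_nonneg (hw0 _) (slabDensity_nonneg hδ _)) ?_ ?_ (by fun_prop) hum hx _
        · rw [halfMeasure_eq_prod]
          exact hwx.mul_prod (integrable_slabDensity δ)
        · rw [halfMeasure_eq_prod, integral_prod_mul (fun y => w (y - x)) (slabDensity δ),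
            integral_slabDensity hδ, integral_sub_right_eq_self w x, hw1, one_mul]
    _ = ∫⁻ x, ∫⁻ y, ENNReal.ofReal (w y) * (ENNReal.ofReal δ⁻¹
        * ∫⁻ t in Set.Ioc δ (2 * δ), ‖f x - u (y + x, t)‖ₑ ^ 2) := by simp_rw [hinner]
    _ = ∫⁻ y, ∫⁻ x, ENNReal.ofReal (w y) * (ENNReal.ofReal δ⁻¹
        * ∫⁻ t in Set.Ioc δ (2 * δ), ‖f x - u (y + x, t)‖ₑ ^ 2) := by
        refine lintegral_lintegral_swap ?_
        have hmI : Measurable fun r : Plane × Plane =>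
            ∫⁻ t in Set.Ioc δ (2 * δ), ‖f r.1 - u (r.2 + r.1, t)‖ₑ ^ 2 :=
          hmF.lintegral_prod_right'
        exact ((ENNReal.measurable_ofReal.comp (hwm.comp measurable_snd)).mul
          (hmI.const_mul _)).aemeasurable
    _ ≤ ∫⁻ y, ENNReal.ofReal (w y) * ENNReal.ofReal (δ⁻¹ * B) := by
        refine lintegral_mono fun y => ?_
        rw [lintegral_const_mul' _ _ ENNReal.ofReal_ne_top,
          lintegral_const_mul' _ _ ENNReal.ofReal_ne_top, lintegral_lintegral_swap (by
            exact (hmF.comp (by fun_prop : Measurable fun q : Plane × ℝ =>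
              (((q.1, y), q.2) : (Plane × Plane) × ℝ))).aemeasurable),
          ENNReal.ofReal_mul (inv_pos.2 hδ).le]
        -- Only displacements with `w y ≠ 0` contribute, and for these `‖y‖ ≤ η`.
        by_cases hy : w y = 0
        · simp [hy]
        gcongr
        refine (lintegral_slab_sub_le hs hδ hc hcle h hu hg hf hA0 hA hrate y).trans ?_
        refine ENNReal.ofReal_le_ofReal ?_
        have := hwη y hy
        rw [hB]
        gcongr
    _ = ENNReal.ofReal (δ⁻¹ * B) := by
        rw [lintegral_mul_const' _ _ ENNReal.ofReal_ne_top,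
          ← ofReal_integral_eq_lintegral_ofReal hwi (ae_of_all _ hw0), hw1, ENNReal.ofReal_one,
          one_mul]

lemma norm_trace_sub_average_le {δ : ℝ} (hs : 0 < s) (hδ : 0 < δ) {c : ℝ} (hc : 0 < c)
    (hcle : ∀ t ∈ Set.Ioc δ (2 * δ), c ≤ t ^ (1 - 2 * s)) (z : extensionSpace V hVc hVpos s)
    {f F : Lp ℝ 2 (volume : Measure Plane)}
    (hrate : HasTraceRate s z.1.fst f (ENNReal.ofReal (‖z.1.snd‖ ^ 2))) {w : Plane → ℝ}
    (hw : Continuous w) (hw0 : ∀ x, 0 ≤ w x) (hwi : Integrable w volume) (hw1 : ∫ x, w x = 1)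
    {η : ℝ} (hwη : ∀ x, w x ≠ 0 → ‖x‖ ≤ η)
    (hF : ∀ᵐ x, Integrable (fun q : Plane × ℝ => w (q.1 - x) * slabDensity δ q.2 * z.1.fst q)
        halfMeasure ∧
      F x = ∫ q, w (q.1 - x) * slabDensity δ q.2 * z.1.fst q ∂halfMeasure) :
    ‖f - F‖ ^ 2 ≤ δ⁻¹ * ((2 * ((2 * δ) ^ (2 * s) / (2 * s) * δ)
      + 2 * (η ^ 2 * c⁻¹)) * ‖z.1.snd‖ ^ 2) := by
  have hest := lintegral_sub_average_le hs hδ hc hcle z.2.2 (Lp.stronglyMeasurable z.1.fst)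
    (Lp.stronglyMeasurable z.1.snd) (Lp.stronglyMeasurable f) (sq_nonneg ‖z.1.snd‖)
    (lintegral_sq_coeFn z.1.snd) hrate hw hw0 hwi hw1 hwη (hF.mono fun x hx => hx.1)
  refine norm_sq_le_of_lintegral_le (by positivity) (le_of_eq_of_le (lintegral_congr_ae ?_) hest)
  filter_upwards [Lp.coeFn_sub f F, hF] with x h1 h2
  rw [h1, Pi.sub_apply, h2.2]

lemma exists_bump {η : ℝ} (hη : 0 < η) : ∃ w : Plane → ℝ, Continuous w ∧ HasCompactSupport w ∧
    (∀ x, 0 ≤ w x) ∧ ∫ x, w x = 1 ∧ ∀ x, w x ≠ 0 → ‖x‖ ≤ η := by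
  let b : ContDiffBump (0 : Plane) := ⟨η / 2, η, half_pos hη, half_lt_self hη⟩
  refine ⟨b.normed volume, b.continuous_normed, b.hasCompactSupport_normed, b.nonneg_normed,
    b.integral_normed, fun x hx => ?_⟩
  have h1 : x ∈ Function.support (b.normed volume) := hx
  rw [b.support_normed_eq, mem_ball_zero_iff] at h1
  exact h1.le

/-- The inclusion of the extension space into the weighted `L²` space. -/
noncomputable def fstL (V : Plane → ℝ) (hVc : Continuous V) (hVpos : ∀ x, 0 < V x) (s : ℝ) :
    extensionSpace V hVc hVpos s →L[ℝ] Lp ℝ 2 (potMeasure V s) :=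
  (WithLp.fstL 2 ℝ (Lp ℝ 2 (potMeasure V s)) (Lp Grad 2 (gradMeasure s))).comp
    (Submodule.subtypeL _)

/-- The order of choice matters: `δ` makes the vertical error small since `s > 0`, the lower bound
`c` of the weight depends on `δ`, and `η` is then taken small relative to both. -/
lemma exists_slab_parameters (hs : 0 < s) {ε : ℝ} (hε : 0 < ε) :
    ∃ δ c η : ℝ, 0 < δ ∧ 0 < c ∧ 0 < η ∧ (∀ t ∈ Set.Ioc δ (2 * δ), c ≤ t ^ (1 - 2 * s)) ∧
      δ⁻¹ * (2 * ((2 * δ) ^ (2 * s) / (2 * s) * δ) + 2 * (η ^ 2 * c⁻¹)) ≤ ε ^ 2 := by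
  obtain ⟨δ, hδlt, hδ⟩ : ∃ δ : ℝ, 2 * ((2 * δ) ^ (2 * s) / (2 * s)) < ε ^ 2 / 2 ∧ 0 < δ := by
    have h1 : Tendsto (fun δ : ℝ => 2 * ((2 * δ) ^ (2 * s) / (2 * s))) (𝓝 0) (𝓝 0) := by
      have h2 : ContinuousAt (fun δ : ℝ => 2 * ((2 * δ) ^ (2 * s) / (2 * s))) 0 :=
        continuousAt_const.mul (((continuousAt_const.mul continuousAt_id).rpow_const
          (Or.inr (by positivity))).div_const _)
      simpa [ContinuousAt, Real.zero_rpow (by positivity : 2 * s ≠ 0)] using h2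
    have h3 : ∀ᶠ δ in 𝓝[>] (0 : ℝ), 2 * ((2 * δ) ^ (2 * s) / (2 * s)) < ε ^ 2 / 2 :=
      (h1.mono_left nhdsWithin_le_nhds).eventually (gt_mem_nhds (by positivity))
    exact (h3.and self_mem_nhdsWithin).exists
  obtain ⟨c, hc, hcle⟩ := exists_le_rpow hδ (1 - 2 * s)
  -- With this `η` the horizontal term `δ⁻¹ · 2 η² c⁻¹` equals `ε²/2`.
  set η := √(ε ^ 2 / 4 * (δ * c)) with hη
  have hηpos : 0 < η := Real.sqrt_pos.2 (by positivity)
  have hηsq : η ^ 2 = ε ^ 2 / 4 * (δ * c) := Real.sq_sqrt (by positivity)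
  refine ⟨δ, c, η, hδ, hc, hηpos, hcle, ?_⟩
  have e1 : δ⁻¹ * (2 * ((2 * δ) ^ (2 * s) / (2 * s) * δ) + 2 * (η ^ 2 * c⁻¹))
      = 2 * ((2 * δ) ^ (2 * s) / (2 * s)) + ε ^ 2 / 2 := by
    rw [hηsq]
    field_simp
    ring
  rw [e1]
  linarith

/-- An operator that can be approximated in norm by compact operators is compact. -/
lemma isCompactOperator_of_forall_norm_sub_le {E F : Type*} [NormedAddCommGroup E]
    [NormedSpace ℝ E] [NormedAddCommGroup F] [NormedSpace ℝ F] [CompleteSpace F] (T : E →L[ℝ] F)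
    (h : ∀ ε : ℝ, 0 < ε → ∃ S : E →L[ℝ] F, IsCompactOperator S ∧ ∀ z, ‖T z - S z‖ ≤ ε * ‖z‖) :
    IsCompactOperator T := by
  have hclosed := isClosed_setOfPred_isCompactOperator (σ₁₂ := RingHom.id ℝ) (M₁ := E) (M₂ := F)
  refine hclosed.closure_subset (Metric.mem_closure_iff.2 fun ε hε => ?_)
  obtain ⟨S, hS, hle⟩ := h (ε / 2) (half_pos hε)
  refine ⟨S, hS, ?_⟩
  rw [dist_eq_norm]
  exact (ContinuousLinearMap.opNorm_le_bound _ (half_pos hε).le hle).trans_lt (half_lt_self hε)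

/-- The trace operator is a limit of Hilbert–Schmidt operators. -/
lemma exists_isCompactOperator_norm_sub_le (hs : 0 < s)
    (hVint : Integrable (fun x => 1 / V x) volume)
    (T : extensionSpace V hVc hVpos s →L[ℝ] Lp ℝ 2 (volume : Measure Plane))
    (hT : ∀ z, HasTraceRate s z.1.fst (T z) (ENNReal.ofReal (‖z.1.snd‖ ^ 2)))
    {ε : ℝ} (hε : 0 < ε) :
    ∃ S : extensionSpace V hVc hVpos s →L[ℝ] Lp ℝ 2 (volume : Measure Plane),
      IsCompactOperator S ∧ ∀ z, ‖T z - S z‖ ≤ ε * ‖z‖ := by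
  obtain ⟨δ, c, η, hδ, hc, hη, hcle, hconst⟩ := exists_slab_parameters hs hε
  obtain ⟨w, hw, hwc, hw0, hw1, hwη⟩ := exists_bump hη
  obtain ⟨S, hS, hSu⟩ := exists_average_operator (s := s) hVc hVpos hVint hδ hw hwc
  have hSP : ∀ z : extensionSpace V hVc hVpos s, (S.comp (fstL V hVc hVpos s)) z = S z.1.fst :=
    fun z => rfl
  refine ⟨S.comp (fstL V hVc hVpos s), hS.comp_clm (fstL V hVc hVpos s), fun z => ?_⟩
  rw [hSP]
  have hsq : ‖T z - S z.1.fst‖ ^ 2 ≤ δ⁻¹ * ((2 * ((2 * δ) ^ (2 * s) / (2 * s) * δ)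
      + 2 * (η ^ 2 * c⁻¹)) * ‖z.1.snd‖ ^ 2) :=
    norm_trace_sub_average_le hs hδ hc hcle z (hT z) hw hw0
      (hw.integrable_of_hasCompactSupport hwc) hw1 hwη (hSu z.1.fst)
  refine (abs_le_of_sq_le_sq' ?_ (by positivity)).2
  calc _ ≤ _ := hsq
    _ = δ⁻¹ * (2 * ((2 * δ) ^ (2 * s) / (2 * s) * δ) + 2 * (η ^ 2 * c⁻¹)) * ‖z.1.snd‖ ^ 2 := by ring
    _ ≤ ε ^ 2 * ‖z‖ ^ 2 := by
        -- The error involves only the gradient part of the norm; the potential part is discarded.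
        refine mul_le_mul hconst ?_ (sq_nonneg _) (sq_nonneg _)
        rw [norm_sq_extensionSpace]
        exact le_add_of_nonneg_left (sq_nonneg _)
    _ = _ := (mul_pow _ _ _).symm

end SchrodingerExtension

theorem mainTheorem9 (s : ℝ) (hs0 : 0 < s) (hs1 : s < 1)
    (V : SchrodingerExtension.Plane → ℝ) (hVc : Continuous V)
    (V₀ : ℝ) (hV₀ : 0 < V₀) (hV : ∀ x, V₀ ≤ V x)
    (hVint : Integrable (fun x => 1 / V x) volume) :
    ∃ T : SchrodingerExtension.extensionSpace V hVc (fun x => hV₀.trans_le (hV x)) s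
        →L[ℝ] Lp ℝ 2 (volume : Measure SchrodingerExtension.Plane),
      (∀ u, SchrodingerExtension.IsTrace u.1.fst (T u)) ∧ IsCompactOperator T := by
  obtain ⟨T, hT⟩ := SchrodingerExtension.exists_trace_operator (hVc := hVc)
    (hVpos := fun x => hV₀.trans_le (hV x)) hs0 hV₀ hV
  exact ⟨T, fun u => SchrodingerExtension.isTrace_of_rate hs0 ENNReal.ofReal_ne_top (hT u),
    SchrodingerExtension.isCompactOperator_of_forall_norm_sub_le T fun _ hε =>
      SchrodingerExtension.exists_isCompactOperator_norm_sub_le hs0 hVint T hT hε⟩
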